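/- **Setting.** Let $\mathcal N=(\mathcal V,\mathcal E,C)$ be a finite directed acyclic multigraph with node set $\mathcal V=\{0,1,\dots,n\}$, $n\ge 1$, numbered in a topological order, with link capacities $C_e>0$, where $0$ is the only node without incoming links (origin) and $n$ the only node without outgoing links (destination). Write $\sigma_e,\tau_e$ for the tail and head of a link $e$, and $\mathcal E_v^+,\mathcal E_v^-$ for the links leaving and entering $v$. Assume that $\mathcal N$ is a *tree*: the undirected multigraph underlying $(\mathcal V\setminus\{n\},\mathcal E\setminus\mathcal E_n^-)$ is a tree. Assume also that $\mathcal N$ is *symmetric*: after giving every link into $n$ its own copy of $n$ as a leaf, one gets a weighted rooted tree in which, recursively, the links leaving the root have equal weights and the subtrees rooted at its children are symmetric and identical to each other. Let $\lambda>0$ be the constant inflow at the origin. **Dynamics.** A routing policy assigns to $v\ne n$, $\emptyset\ne\mathcal J\subseteq\mathcal E_v^+$ and $\mu\ge0$ a vector $G^v(\mathcal J,\mu)\in\mathbb R_+^{\mathcal J}$ with $\sum_{e\in\mathcal J}G^v_e(\mathcal J,\mu)=\mu$; it is *distributed* if also $G^v_e(\mathcal J,\mu)\le G^v_e(\mathcal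 K,\mu)$ whenever $e\in\mathcal K\subseteq\mathcal J$. A disturbance process is a sequence $\delta(1),\delta(2),\ldots\in\mathbb R_+^{\mathcal E}$ with $\sum_{s\le t}\delta(s)\le C$ for all $t$; its magnitude is $\mathcal D(\delta)=\sum_{e}\sum_{t\ge1}\delta_e(t)$. Let $\mathcal E_v^{\pm}(t)=\mathcal E_v^{\pm}\cap\mathcal E(t)$ and let $\lambda_v(t)=\lambda\mathbf 1_{v=0}+\sum_{e\in\mathcal E_v^-(t)}f_e(t)$. Start with $\mathcal V(0)=\mathcal V\setminus\{n\}$, $\mathcal E(0)=\mathcal E$, $C(0)=C$ and the flow $f(0)$ determined by $f_e(0)=G^{\sigma_e}_e(\mathcal E^+_{\sigma_e},\lambda_{\sigma_e}(0))$, and for $t\ge 0$ put $$\mathcal E(t+1)=\{e\in\mathcal E(t): f_e(t)<C_e(t),\ \tau_e\in\mathcal V(t)\cup\{n\}\},\qquad \mathcal V(t+1)=\{v\in\mathcal V(t):\mathcal E_v^+(t)\neq\emptyset\},$$ $$f_e(t+1)=G_e^{v}(\mathcal E_{v}^+(t),\lambda_{v}(t))\ \ (e\in\mathcal E_v^+(t)),\qquad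 f_e(t+1)=0\ \ (e\notin\mathcal E(t)),\qquad C(t+1)=C(t)-\delta(t+1).$$ The dynamics is *transferring* if $\lim_{t\to\infty}\sum_{e\in\mathcal E_n^-}f_e(t)=\lambda$. The margin of resilience $\mathcal R(\mathcal N,\lambda,\mathcal G)$ is the infimum of $\mathcal D(\delta)$ over the disturbance processes for which it is not transferring. **Backward Propagation Algorithm.** For $\mathcal J\subseteq\mathcal E_v^+$ let $\mathcal X_v(\mathcal J,r,\mu)=\{x\in\mathbb R_+^{\mathcal J}: r_e\le x_e\le C_e\ (e\in\mathcal J),\ \sum_{e\in\mathcal J} x_e=\mu\}$. Define $S(\mathcal E_n^+,r,\mu)=+\infty$ and, for $v=n-1,\dots,0$, $S(\emptyset,r,\mu)=0$, $S(\mathcal J,r,\mu)=0$ if $\mathcal X_v(\mathcal J,r,\mu)=\emptyset$, and otherwise $$S(\mathcal J,r,\mu)=\sup_{x\in\mathcal X_v(\mathcal J,r,\mu)}\min_{e\in\mathcal J}\bigl(S_e(x_e)+S(\mathcal J\setminus\{e\},x,\mu)\bigr),\qquad S_e(\mu)=\min\{[C_e-\mu]^+,S(\mathcal E_{\tau_e}^+,\mathbf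 0,\mu)\}.$$ Let $g(\mathcal J,r,\mu)$ be the set of maximizers and $S^*(\mathcal N,\lambda)=S(\mathcal E_0^+,\mathbf 0,\lambda)$. A routing policy is a *BPA routing* if for all $v\ne n$, $\mu\ge0$ one has $r^*:=G^v(\mathcal E_v^+,\mu)\in g(\mathcal E_v^+,\mathbf 0,\mu)$ and $G^v(\mathcal J,\mu)\in g(\mathcal J,r^*,\mu)$ for all $\emptyset\ne\mathcal J\subsetneq\mathcal E_v^+$, each requirement being imposed only where the corresponding set $\mathcal X_v$ is non-empty. **Proposition.** Under BPA routing on a symmetric tree $\mathcal N$ with constant inflow $\lambda>0$ at the origin, the dynamics is transferring for every disturbance process $\delta$ with $\mathcal D(\delta)<S^*(\mathcal N,\lambda)$. Consequently BPA routing is maximally resilient: $\mathcal R(\mathcal N,\lambda,\mathcal G)=\sup_{\mathcal G'}\mathcal R(\mathcal N,\lambda,\mathcal G')$, the supremum being over all distributed routing policies $\mathcal G'$. -/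

import Mathlib

open Filter Topology
open scoped ENNReal

/-- A finite directed multigraph with link set `E`, node set `{0, …, n}`, and strictly positive link
capacities. Node `0` is the only origin (node without incoming links), node `n` is the only
destination (node without outgoing links), and they are distinct. The graph is acyclic and the nodes
are numbered in a topological order. -/
structure FlowNetwork (n : ℕ) (E : Type*) where
  tail : E → Fin (n + 1)
  head : E → Fin (n + 1)
  cap : E → ℝ
  cap_pos : ∀ e, 0 < cap e
  n_pos : 0 < n
  tail_lt_head : ∀ e, tail e < head e
  exists_in : ∀ v, v ≠ 0 → ∃ e, head e = v
  exists_out : ∀ v, v ≠ Fin.last n → ∃ e, tail e = v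

/-- A policy: `G v J μ e` is the flow that node `v` sends on link `e` when its set of active outgoing
links is `J` and its inflow is `μ`. -/
abbrev RoutingMap (n : ℕ) (E : Type*) : Type _ := Fin (n + 1) → Finset E → ℝ → E → ℝ

/-- State of the flow dynamics: active non-destination nodes, active links, link flows and residual
capacities. -/
structure FlowState (n : ℕ) (E : Type*) where
  nodes : Finset (Fin (n + 1))
  links : Finset E
  flow : E → ℝ
  rescap : E → ℝ

/-- Vectors `x ∈ ℝ₊^J` (extended by zero outside `J`) with `r ≤ x ≤ C` on `J` and total mass `μ`. -/
def feasibleSplits {E : Type*} (C : E → ℝ) (J : Finset E) (r : E → ℝ) (μ : ℝ) : Set (E → ℝ) :=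
  {x | (∀ e ∈ J, 0 ≤ x e ∧ r e ≤ x e ∧ x e ≤ C e) ∧ (∀ e, e ∉ J → x e = 0) ∧ ∑ e ∈ J, x e = μ}

/-- Total capacity removed by the disturbance `δ(1), δ(2), …`. -/
noncomputable def disturbanceMagnitude {E : Type*} [Fintype E] (δ : ℕ → E → ℝ) : ℝ≥0∞ :=
  ∑ e, ∑' t : ℕ, ENNReal.ofReal (δ (t + 1) e)

namespace FlowNetwork

section Topology

variable {n : ℕ} {E : Type*} (N : FlowNetwork n E)

/-- The simple graph underlying the network with the destination and its incoming links removed. -/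
def underlyingGraph : SimpleGraph {v : Fin (n + 1) // v ≠ Fin.last n} :=
  SimpleGraph.fromRel (fun u w => ∃ e, N.tail e = u.1 ∧ N.head e = w.1)

/-- The multigraph left after removing the destination and its incoming links is a directed tree: its
underlying undirected multigraph is a tree, so in particular there are no parallel links in it. -/
def IsDirectedTree : Prop :=
  N.underlyingGraph.IsTree ∧
    ∀ e e', N.head e ≠ Fin.last n → N.tail e = N.tail e' → N.head e = N.head e' → e = e'

/-- The weighted rooted trees hanging from two nodes are identical (isomorphic with the same link
weights). Every link into the destination ends in a leaf of its own. -/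
inductive SameSubtree : Fin (n + 1) → Fin (n + 1) → Prop
  | leaf : SameSubtree (Fin.last n) (Fin.last n)
  | node (u w : Fin (n + 1)) (hu : u ≠ Fin.last n) (hw : w ≠ Fin.last n)
      (φ : {e : E // N.tail e = u} ≃ {e : E // N.tail e = w})
      (hcap : ∀ e, N.cap (φ e).1 = N.cap e.1)
      (hsub : ∀ e, SameSubtree (N.head e.1) (N.head (φ e).1)) : SameSubtree u w

/-- The weighted rooted tree hanging from a node is symmetric: the links leaving the root have equal
weights, and the subtrees rooted at the children are symmetric and identical to each other. -/
inductive SymmetricAt : Fin (n + 1) → Prop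
  | leaf : SymmetricAt (Fin.last n)
  | node (v : Fin (n + 1)) (hv : v ≠ Fin.last n)
      (hcap : ∀ e e', N.tail e = v → N.tail e' = v → N.cap e = N.cap e')
      (hsub : ∀ e, N.tail e = v → SymmetricAt (N.head e))
      (hsame : ∀ e e', N.tail e = v → N.tail e' = v → N.SameSubtree (N.head e) (N.head e')) :
      SymmetricAt v

/-- The network is symmetric. -/
def IsSymmetric : Prop := N.SymmetricAt 0

/-- Disturbance processes `δ(1), δ(2), …`: nonnegative capacity reductions that never remove more than
the capacity of a link. -/
def IsDisturbance (δ : ℕ → E → ℝ) : Prop :=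
  (∀ t e, 0 ≤ δ (t + 1) e) ∧ ∀ t e, ∑ s ∈ Finset.range t, δ (s + 1) e ≤ N.cap e

end Topology

section Dynamics

variable {n : ℕ} {E : Type*} [Fintype E] [DecidableEq E] (N : FlowNetwork n E)

/-- Outgoing links of `v`. -/
def outLinks (v : Fin (n + 1)) : Finset E := Finset.univ.filter (fun e => N.tail e = v)

/-- Incoming links of `v`. -/
def inLinks (v : Fin (n + 1)) : Finset E := Finset.univ.filter (fun e => N.head e = v)

/-- `G` splits every inflow among the active outgoing links. -/
def IsRoutingPolicy (G : RoutingMap n E) : Prop :=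
  ∀ v, v ≠ Fin.last n → ∀ J : Finset E, J ⊆ N.outLinks v → J.Nonempty → ∀ μ : ℝ, 0 ≤ μ →
    (∀ e, 0 ≤ G v J μ e) ∧ (∀ e, e ∉ J → G v J μ e = 0) ∧ ∑ e ∈ J, G v J μ e = μ

/-- Distributed oblivious routing policies: routing policies with the link monotonicity property. -/
def IsDistributedPolicy (G : RoutingMap n E) : Prop :=
  N.IsRoutingPolicy G ∧
    ∀ v, v ≠ Fin.last n → ∀ J K : Finset E, J ⊆ N.outLinks v → K ⊆ J → K.Nonempty →
      ∀ μ : ℝ, 0 ≤ μ → ∀ e ∈ K, G v J μ e ≤ G v K μ e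

/-- Inflow at the nodes for the initial flow, when all links are active and every node routes its
inflow by `G`. -/
noncomputable def initialInflow (lam : ℝ) (G : RoutingMap n E) (v : Fin (n + 1)) : ℝ :=
  (if v = 0 then lam else 0) +
    ∑ e : {e : E // N.head e = v},
      G (N.tail e.1) (N.outLinks (N.tail e.1)) (initialInflow lam G (N.tail e.1)) e.1
termination_by v.val
decreasing_by
  have h := N.tail_lt_head e.1
  rw [e.2] at h
  exact h

/-- The initial state: everything is active, nothing is removed, and the flow is the one that the
policy induces from the external inflow `lam` at the origin. -/
noncomputable def initialState (lam : ℝ) (G : RoutingMap n E) : FlowState n E where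
  nodes := Finset.univ.erase (Fin.last n)
  links := Finset.univ
  flow := fun e => G (N.tail e) (N.outLinks (N.tail e)) (N.initialInflow lam G (N.tail e)) e
  rescap := N.cap

/-- Active outgoing links of `v`. -/
def activeOut (s : FlowState n E) (v : Fin (n + 1)) : Finset E := N.outLinks v ∩ s.links

/-- Current inflow of `v`: the external inflow plus the flow on the active incoming links. -/
noncomputable def inflow (lam : ℝ) (s : FlowState n E) (v : Fin (n + 1)) : ℝ :=
  (if v = 0 then lam else 0) + ∑ e ∈ N.inLinks v ∩ s.links, s.flow e

open Classical in
/-- One step of the dynamics, where `d` is the capacity reduction applied in it. A link becomes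
inactive when it is overloaded or its head is an inactive node (the destination never is one), a node
becomes inactive when it has no active outgoing link. Inactive links carry no flow. -/
noncomputable def step (lam : ℝ) (G : RoutingMap n E) (d : E → ℝ) (s : FlowState n E) :
    FlowState n E where
  nodes := s.nodes.filter (fun v => (N.activeOut s v).Nonempty)
  links := s.links.filter
    (fun e => s.flow e < s.rescap e ∧ (N.head e = Fin.last n ∨ N.head e ∈ s.nodes))
  flow := fun e =>
    if e ∈ s.links then G (N.tail e) (N.activeOut s (N.tail e)) (N.inflow lam s (N.tail e)) e else 0
  rescap := fun e => s.rescap e - d e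

/-- The state at time `t` under the disturbance process `δ`. -/
noncomputable def state (lam : ℝ) (G : RoutingMap n E) (δ : ℕ → E → ℝ) : ℕ → FlowState n E
  | 0 => N.initialState lam G
  | t + 1 => N.step lam G (δ (t + 1)) (state lam G δ t)

/-- The flow that reaches the destination converges to the external inflow. -/
def IsTransferring (lam : ℝ) (G : RoutingMap n E) (δ : ℕ → E → ℝ) : Prop :=
  Tendsto (fun t => ∑ e ∈ N.inLinks (Fin.last n), (N.state lam G δ t).flow e) atTop (𝓝 lam)

/-- Margin of resilience of the network under the policy `G`. -/
noncomputable def resilience (lam : ℝ) (G : RoutingMap n E) : ℝ≥0∞ :=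
  ⨅ (δ : ℕ → E → ℝ) (_ : N.IsDisturbance δ) (_ : ¬ N.IsTransferring lam G δ),
    disturbanceMagnitude δ

/-- The largest margin of resilience among all distributed routing policies. -/
noncomputable def maxResilience (lam : ℝ) : ℝ≥0∞ :=
  ⨆ (G : RoutingMap n E) (_ : N.IsDistributedPolicy G), N.resilience lam G

open Classical in
/-- The functions `S(J, r, μ)`, `J ⊆ E_v⁺`, of the Backward Propagation Algorithm. For `J = {e}` with
a feasible split the maximum has only the candidate `x e = μ`, so the recursion gives the value
`min {C e - μ, S(E_{head e}⁺, 0, μ)}`. The restriction `N.tail e = v` is automatic for `J ⊆ E_v⁺`. -/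
noncomputable def bpaValue (v : Fin (n + 1)) (J : Finset E) (r : E → ℝ) (μ : ℝ) : ℝ≥0∞ :=
  if v = Fin.last n then ⊤
  else if J = ∅ ∨ ¬ (feasibleSplits N.cap J r μ).Nonempty then 0
  else ⨆ x ∈ feasibleSplits N.cap J r μ, ⨅ (e : E) (_ : e ∈ J ∧ N.tail e = v),
    (min (ENNReal.ofReal (N.cap e - x e)) (bpaValue (N.head e) (N.outLinks (N.head e)) 0 (x e))
      + bpaValue v (J.erase e) x μ)
termination_by (n - v.val, J.card)
decreasing_by
  · rename_i h
    have h1 : v.val < (N.head e).val := h.2 ▸ N.tail_lt_head e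
    have := (N.head e).isLt
    exact Prod.Lex.left _ _ (by omega)
  · rename_i h
    exact Prod.Lex.right _ (Finset.card_erase_lt_of_mem h.1)

/-- `S_e(μ)`: the smaller of the spare capacity of `e` and the value of its head node. -/
noncomputable def linkValue (e : E) (μ : ℝ) : ℝ≥0∞ :=
  min (ENNReal.ofReal (N.cap e - μ)) (N.bpaValue (N.head e) (N.outLinks (N.head e)) 0 μ)

/-- The quantity that is maximized over `x` in the Backward Propagation Algorithm. -/
noncomputable def bpaObjective (v : Fin (n + 1)) (J : Finset E) (μ : ℝ) (x : E → ℝ) : ℝ≥0∞ :=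
  ⨅ e ∈ J, (N.linkValue e (x e) + N.bpaValue v (J.erase e) x μ)

theorem bpaValue_eq {v : Fin (n + 1)} (hv : v ≠ Fin.last n) {J : Finset E}
    (hJ : J ⊆ N.outLinks v) (hne : J.Nonempty) (r : E → ℝ) (μ : ℝ) :
    N.bpaValue v J r μ = ⨆ x ∈ feasibleSplits N.cap J r μ, N.bpaObjective v J μ x := by
  have key : ∀ e, (e ∈ J ∧ N.tail e = v) ↔ e ∈ J := fun e =>
    ⟨fun h => h.1, fun h => ⟨h, (Finset.mem_filter.1 (hJ h)).2⟩⟩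
  rw [bpaValue, if_neg hv]
  by_cases hX : (feasibleSplits N.cap J r μ).Nonempty
  · rw [if_neg (by simp [hne.ne_empty, hX])]
    simp only [bpaObjective, linkValue, key]
  · rw [if_pos (Or.inr hX), Set.not_nonempty_iff_eq_empty.1 hX]
    simp

/-- The set `g(J, r, μ)` of maximizers. -/
def bpaArgmax (v : Fin (n + 1)) (J : Finset E) (r : E → ℝ) (μ : ℝ) : Set (E → ℝ) :=
  {x | x ∈ feasibleSplits N.cap J r μ ∧
    ∀ y ∈ feasibleSplits N.cap J r μ, N.bpaObjective v J μ y ≤ N.bpaObjective v J μ x}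

/-- BPA routing: with all links active the policy takes a maximizer without lower bound, `r*`; with a
proper subset of them active it takes a maximizer above `r*`. The requirement is void where there is
no feasible split at all, e.g. when the inflow exceeds the capacity of the active links. -/
def IsBPARouting (G : RoutingMap n E) : Prop :=
  ∀ v, v ≠ Fin.last n → ∀ μ : ℝ, 0 ≤ μ →
    ((feasibleSplits N.cap (N.outLinks v) 0 μ).Nonempty →
      G v (N.outLinks v) μ ∈ N.bpaArgmax v (N.outLinks v) 0 μ) ∧
    ∀ J : Finset E, J ⊂ N.outLinks v → J.Nonempty →
      (feasibleSplits N.cap J (G v (N.outLinks v) μ) μ).Nonempty →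
      G v J μ ∈ N.bpaArgmax v J (G v (N.outLinks v) μ) μ

/-- The output `S*(N, lam)` of the Backward Propagation Algorithm. -/
noncomputable def bpaBound (lam : ℝ) : ℝ≥0∞ := N.bpaValue 0 (N.outLinks 0) 0 lam

end Dynamics

end FlowNetwork

/-! By symmetry all links leaving a node have the same value function `ℓ`, strictly decreasing while
positive (`uniformAt_of_isSymmetric`). This solves the recursion: `S(J, r, μ) = ∑ i ∈ {1, …, |J|},
ℓ(μ / i)` as soon as `r ≤ μ / |J|` on `J`, because every split loads some link with at least the
mean, and the even split attains the bound. Strictness makes it the only maximizer where `ℓ(μ / |J|)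
> 0`, so BPA routing splits evenly there (`IsBPARouting.isEvenWherePositive`).

The dynamics becomes stationary, and it is transferring exactly when the origin never loses its last
link. So the question is the price of making the origin fail, and both bounds give `S*`.

Lower bound: under even splitting, a link that fails while `k` links of its node are active carries
at most `μ / k`, so its failure costs at least `ℓ(μ / k)` on it or below it. Summing over the links
of the node gives its value (`nodeValue_le_subtreeDamage`); in a tree the damages below different
links add up without overlap.

Upper bound, for an arbitrary routing policy: in a settled state some link carries at least the
mean. The attacker follows such links down, takes away the spare capacity of one link, waits until
the network settles, and repeats. The money spent plus the price of the remaining attack never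
exceeds `S*` (`AttackCost.exists_target`). -/

namespace FlowNetwork

/-! ### Solving the recursion by even splits -/

section Values

variable {n : ℕ} {E : Type*} [Fintype E] [DecidableEq E] {N : FlowNetwork n E}

omit [DecidableEq E] in
theorem mem_outLinks {v : Fin (n + 1)} {e : E} : e ∈ N.outLinks v ↔ N.tail e = v := by
  simp [outLinks]

omit [DecidableEq E] in
theorem mem_inLinks {v : Fin (n + 1)} {e : E} : e ∈ N.inLinks v ↔ N.head e = v := by
  simp [inLinks]

omit [Fintype E] [DecidableEq E] in
theorem tail_ne_last (N : FlowNetwork n E) (e : E) : N.tail e ≠ Fin.last n :=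
  ((N.tail_lt_head e).trans_le (Fin.le_last _)).ne

omit [Fintype E] [DecidableEq E] in
theorem head_ne_zero (N : FlowNetwork n E) (e : E) : N.head e ≠ 0 :=
  ((Fin.zero_le _).trans_lt (N.tail_lt_head e)).ne'

omit [Fintype E] [DecidableEq E] in
theorem zero_ne_last (N : FlowNetwork n E) : (0 : Fin (n + 1)) ≠ Fin.last n := by
  intro h
  have := congrArg Fin.val h
  have := N.n_pos
  simp_all

omit [DecidableEq E] in
theorem outLinks_nonempty {v : Fin (n + 1)} (hv : v ≠ Fin.last n) : (N.outLinks v).Nonempty := by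
  obtain ⟨e, he⟩ := N.exists_out v hv
  exact ⟨e, mem_outLinks.2 he⟩

omit [Fintype E] [DecidableEq E] in
theorem SymmetricAt.head {e : E} (h : N.SymmetricAt (N.tail e)) : N.SymmetricAt (N.head e) := by
  generalize hv : N.tail e = v at h
  cases h with
  | leaf => exact absurd hv (N.tail_ne_last e)
  | node _ _ _ hsub _ => exact hsub e hv

omit [Fintype E] [DecidableEq E] in
theorem symmetricAt_of_isSymmetric (hSymm : N.IsSymmetric) (v : Fin (n + 1)) :
    N.SymmetricAt v := by
  induction v using WellFoundedLT.induction with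
  | ind v ih =>
    by_cases h0 : v = 0
    · exact h0 ▸ hSymm
    · obtain ⟨e, rfl⟩ := N.exists_in v h0
      exact (ih _ (N.tail_lt_head e)).head

/-- The value of a node that has all its outgoing links. -/
noncomputable def nodeValue (N : FlowNetwork n E) (v : Fin (n + 1)) (μ : ℝ) : ℝ≥0∞ :=
  N.bpaValue v (N.outLinks v) 0 μ

theorem linkValue_eq (e : E) (μ : ℝ) :
    N.linkValue e μ = min (ENNReal.ofReal (N.cap e - μ)) (N.nodeValue (N.head e) μ) := rfl

theorem nodeValue_last (μ : ℝ) : N.nodeValue (Fin.last n) μ = ⊤ := by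
  rw [nodeValue, bpaValue, if_pos rfl]

theorem linkValue_ne_top (e : E) (μ : ℝ) : N.linkValue e μ ≠ ⊤ :=
  ((min_le_left _ _).trans_lt ENNReal.ofReal_lt_top).ne

theorem linkValue_eq_zero {e : E} {μ : ℝ} (h : N.cap e ≤ μ) : N.linkValue e μ = 0 := by
  rw [linkValue_eq, ENNReal.ofReal_eq_zero.2 (by linarith), zero_min]

/-- The total value of the even splits of `μ` among `k, k - 1, …, 1` copies of `e`. -/
noncomputable def evenValue (N : FlowNetwork n E) (e : E) (k : ℕ) (μ : ℝ) : ℝ≥0∞ :=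
  ∑ i ∈ Finset.range k, N.linkValue e (μ / (i + 1 : ℕ))

theorem evenValue_succ (e : E) (k : ℕ) (μ : ℝ) :
    N.evenValue e (k + 1) μ = N.evenValue e k μ + N.linkValue e (μ / (k + 1 : ℕ)) :=
  Finset.sum_range_succ _ _

theorem evenValue_mono (e : E) (μ : ℝ) : Monotone fun k => N.evenValue e k μ := fun _ _ h =>
  Finset.sum_le_sum_of_subset (Finset.range_subset_range.2 h)

theorem evenValue_ne_top (e : E) (k : ℕ) (μ : ℝ) : N.evenValue e k μ ≠ ⊤ :=
  ENNReal.sum_ne_top.2 fun _ _ => linkValue_ne_top _ _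

/-- All links leaving `v` have the same value function, which is strictly decreasing as long as it is
positive. -/
structure UniformAt (N : FlowNetwork n E) (v : Fin (n + 1)) : Prop where
  eq : ∀ e e', N.tail e = v → N.tail e' = v → ∀ μ, 0 ≤ μ → N.linkValue e μ = N.linkValue e' μ
  capEq : ∀ e e', N.tail e = v → N.tail e' = v → N.cap e = N.cap e'
  strict : ∀ e, N.tail e = v → ∀ x y, 0 ≤ x → x < y → 0 < N.linkValue e y →
    N.linkValue e y < N.linkValue e x

namespace UniformAt

variable {v : Fin (n + 1)} (hU : N.UniformAt v)
include hU

theorem anti {e : E} (he : N.tail e = v) {x y : ℝ} (hx : 0 ≤ x) (hxy : x ≤ y) :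
    N.linkValue e y ≤ N.linkValue e x := by
  rcases hxy.eq_or_lt with rfl | h
  · exact le_rfl
  · rcases eq_zero_or_pos (N.linkValue e y) with h0 | h0
    · rw [h0]; exact zero_le
    · exact (hU.strict e he x y hx h h0).le

theorem le_of_linkValue_le {e : E} (he : N.tail e = v) {x y : ℝ} (hx : 0 ≤ x)
    (hpos : 0 < N.linkValue e x) (h : N.linkValue e x ≤ N.linkValue e y) : y ≤ x := by
  by_contra! hlt
  exact (hU.strict e he x y hx hlt (hpos.trans_le h)).not_ge h

/-- The last summand has the smallest load, hence the largest value; if it vanishes, all do. This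
settles the cases where the even split is infeasible. -/
theorem evenValue_eq_zero {e : E} (he : N.tail e = v) {k : ℕ} {μ : ℝ} (hμ : 0 ≤ μ)
    (h : N.linkValue e (μ / k) = 0) : N.evenValue e k μ = 0 := by
  refine Finset.sum_eq_zero fun i hi => ?_
  have hik : i + 1 ≤ k := Finset.mem_range.1 hi
  refine le_antisymm (h ▸ hU.anti he (by positivity) ?_) zero_le
  exact div_le_div_of_nonneg_left hμ (by positivity) (by exact_mod_cast hik)

omit [Fintype E] [DecidableEq E] hU in
theorem exists_even_le_of_sum {J : Finset E} (hne : J.Nonempty) {x : E → ℝ} {μ : ℝ}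
    (hx : ∑ e ∈ J, x e = μ) : ∃ e ∈ J, μ / J.card ≤ x e := by
  refine Finset.exists_le_of_sum_le hne ?_
  have : (J.card : ℝ) ≠ 0 := by exact_mod_cast hne.card_ne_zero
  rw [hx, Finset.sum_const, nsmul_eq_mul, mul_div_cancel₀ _ this]

/-- Whatever the split, the minimum is at most the term of a link that carries at least the mean;
induction on `J` bounds the rest of that term. -/
theorem bpaValue_le {e₀ : E} (he₀ : N.tail e₀ = v) {μ : ℝ} (hμ : 0 ≤ μ) (J : Finset E) :
    J ⊆ N.outLinks v → ∀ r, N.bpaValue v J r μ ≤ N.evenValue e₀ J.card μ := by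
  have hv : v ≠ Fin.last n := he₀ ▸ N.tail_ne_last e₀
  induction J using Finset.strongInduction with
  | H J ih =>
    intro hJ r
    rcases J.eq_empty_or_nonempty with rfl | hne
    · rw [bpaValue, if_neg hv, if_pos (Or.inl rfl)]; exact zero_le
    rw [bpaValue_eq N hv hJ hne]
    refine iSup₂_le fun x hx => ?_
    obtain ⟨e, heJ, hle⟩ := exists_even_le_of_sum hne hx.2.2
    have het : N.tail e = v := mem_outLinks.1 (hJ heJ)
    refine (iInf₂_le e heJ).trans ?_
    have hc : J.card = (J.erase e).card + 1 := (Finset.card_erase_add_one heJ).symm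
    rw [hc, evenValue_succ, add_comm, ← hc]
    gcongr
    · exact ih _ (Finset.erase_ssubset heJ) ((Finset.erase_subset _ _).trans hJ) x
    · exact (hU.anti het (by positivity) hle).trans
        (hU.eq e e₀ het he₀ _ (by positivity)).le

omit [Fintype E] hU in
theorem even_mem_feasibleSplits {C : E → ℝ} {J : Finset E} (hne : J.Nonempty) {r : E → ℝ} {μ : ℝ}
    (hμ : 0 ≤ μ) (hr : ∀ e ∈ J, r e ≤ μ / J.card) (hC : ∀ e ∈ J, μ / J.card ≤ C e) :
    (fun e => if e ∈ J then μ / J.card else 0) ∈ feasibleSplits C J r μ := by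
  refine ⟨fun e he => ?_, fun e he => if_neg he, ?_⟩
  · simp only [he, if_true]
    exact ⟨by positivity, hr e he, hC e he⟩
  · have : (J.card : ℝ) ≠ 0 := by exact_mod_cast hne.card_ne_zero
    rw [Finset.sum_congr rfl fun e he => if_pos he, Finset.sum_const, nsmul_eq_mul,
      mul_div_cancel₀ _ this]

/-- The inductive step of `le_bpaValue`, kept apart because the comparison of a maximizer with the
even split uses it again. -/
theorem le_bpaObjective_even {e₀ : E} (he₀ : N.tail e₀ = v) {μ : ℝ} (hμ : 0 ≤ μ) (J : Finset E)
    (hJ : J ⊆ N.outLinks v)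
    (ih : ∀ e ∈ J, ∀ r : E → ℝ, (∀ e' ∈ J.erase e, r e' ≤ μ / (J.erase e).card) →
      N.evenValue e₀ (J.erase e).card μ ≤ N.bpaValue v (J.erase e) r μ) :
    N.evenValue e₀ J.card μ ≤
      N.bpaObjective v J μ (fun e => if e ∈ J then μ / J.card else 0) := by
  refine le_iInf₂ fun e heJ => ?_
  have het : N.tail e = v := mem_outLinks.1 (hJ heJ)
  have hc : J.card = (J.erase e).card + 1 := (Finset.card_erase_add_one heJ).symm
  rw [show N.evenValue e₀ J.card μ = N.evenValue e₀ (J.erase e).card μ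
    + N.linkValue e₀ (μ / J.card) by rw [hc, evenValue_succ, ← hc], add_comm]
  simp only [heJ, if_true]
  gcongr
  · exact (hU.eq e₀ e he₀ het _ (by positivity)).le
  -- The even split of `J` is a valid lower bound for `J.erase e`: with fewer links the mean grows.
  · refine ih e heJ _ fun e' he' => ?_
    rw [if_pos (Finset.mem_of_mem_erase he')]
    have : 0 < (J.erase e).card := Finset.card_pos.2 ⟨e', he'⟩
    exact div_le_div_of_nonneg_left hμ (by exact_mod_cast this) (by exact_mod_cast by omega)

theorem le_bpaValue {e₀ : E} (he₀ : N.tail e₀ = v) {μ : ℝ} (hμ : 0 ≤ μ) (J : Finset E) :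
    J ⊆ N.outLinks v → ∀ r : E → ℝ, (∀ e ∈ J, r e ≤ μ / J.card) →
      N.evenValue e₀ J.card μ ≤ N.bpaValue v J r μ := by
  have hv : v ≠ Fin.last n := he₀ ▸ N.tail_ne_last e₀
  induction J using Finset.strongInduction with
  | H J ih =>
    intro hJ r hr
    rcases J.eq_empty_or_nonempty with rfl | hne
    · simp [evenValue]
    by_cases hC : N.cap e₀ ≤ μ / J.card
    · rw [hU.evenValue_eq_zero he₀ hμ (linkValue_eq_zero hC)]; exact zero_le
    rw [bpaValue_eq N hv hJ hne]
    refine le_iSup₂_of_le _ (even_mem_feasibleSplits hne hμ hr fun e he => ?_)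
      (hU.le_bpaObjective_even he₀ hμ J hJ fun e he r hr' =>
        ih _ (Finset.erase_ssubset he) ((Finset.erase_subset _ _).trans hJ) r hr')
    rw [hU.capEq e e₀ (mem_outLinks.1 (hJ he)) he₀]
    exact (not_le.1 hC).le

theorem nodeValue_eq {e : E} (he : N.tail e = v) {μ : ℝ} (hμ : 0 ≤ μ) :
    N.nodeValue v μ = N.evenValue e (N.outLinks v).card μ :=
  le_antisymm (hU.bpaValue_le he hμ _ subset_rfl _)
    (hU.le_bpaValue he hμ _ subset_rfl _ fun _ _ => by simp only [Pi.zero_apply]; positivity)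

theorem nodeValue_strict {x y : ℝ} (hv : v ≠ Fin.last n) (hx : 0 ≤ x) (hxy : x < y)
    (hpos : 0 < N.nodeValue v y) : N.nodeValue v y < N.nodeValue v x := by
  obtain ⟨e, he⟩ := N.exists_out v hv
  have hy := hx.trans hxy.le
  rw [hU.nodeValue_eq he hy] at hpos ⊢
  rw [hU.nodeValue_eq he hx]
  -- A positive total forces the summand with the smallest load to be positive, and that one
  -- decreases strictly.
  have hlast : 0 < N.linkValue e (y / (N.outLinks v).card) := by
    by_contra! h
    rw [hU.evenValue_eq_zero he hy (le_antisymm h zero_le)] at hpos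
    exact lt_irrefl _ hpos
  obtain ⟨k, hk⟩ := Nat.exists_eq_succ_of_ne_zero (outLinks_nonempty (N := N) hv).card_ne_zero
  rw [hk] at hlast ⊢
  rw [Nat.succ_eq_add_one, evenValue_succ, evenValue_succ]
  refine ENNReal.add_lt_add_of_le_of_lt (evenValue_ne_top _ _ _) ?_ ?_
  · refine Finset.sum_le_sum fun i _ => hU.anti he (by positivity) ?_
    gcongr
  · exact hU.strict e he _ _ (by positivity) (by gcongr) hlast

end UniformAt

/-- The closed form of the value depends only on the number of links, their capacity and the values
of the heads. The threshold `m` lets the downward induction for `UniformAt` call this with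
uniformity known only beyond the current node. -/
theorem SameSubtree.nodeValue_eq {m u w : Fin (n + 1)} (hS : N.SameSubtree u w)
    (hU : ∀ v, m < v → N.UniformAt v) (hu : m < u) (hw : m < w) :
    ∀ μ, 0 ≤ μ → N.nodeValue u μ = N.nodeValue w μ := by
  induction hS with
  | leaf => exact fun _ _ => rfl
  | node u w hul hwl φ hcap hsub ih =>
    intro μ hμ
    obtain ⟨e, he⟩ := N.exists_out u hul
    rw [(hU u hu).nodeValue_eq he hμ, (hU w hw).nodeValue_eq (φ ⟨e, he⟩).2 hμ]
    have hcard : (N.outLinks u).card = (N.outLinks w).card := by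
      simp only [outLinks, ← Fintype.card_subtype]
      exact Fintype.card_congr φ
    rw [hcard]
    refine Finset.sum_congr rfl fun i _ => ?_
    rw [linkValue_eq, linkValue_eq, hcap ⟨e, he⟩, ih ⟨e, he⟩ _ _ _ (by positivity)]
    · exact hu.trans (he ▸ N.tail_lt_head e)
    · exact hw.trans ((φ ⟨e, he⟩).2.ge.trans_lt (N.tail_lt_head _))

theorem uniformAt_of_isSymmetric (hSymm : N.IsSymmetric) (v : Fin (n + 1)) : N.UniformAt v := by
  induction v using WellFoundedGT.induction with
  | ind v ih =>
    by_cases hv : v = Fin.last n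
    · subst hv
      exact ⟨fun e _ h => absurd h (N.tail_ne_last e), fun e _ h => absurd h (N.tail_ne_last e),
        fun e h => absurd h (N.tail_ne_last e)⟩
    cases symmetricAt_of_isSymmetric hSymm v with
    | leaf => exact absurd rfl hv
    | node _ _ hcap hsub hsame =>
      have hlt : ∀ e, N.tail e = v → v < N.head e := fun e he => he ▸ N.tail_lt_head e
      refine ⟨fun e e' he he' μ hμ => ?_, hcap, fun e he x y hx hxy hpos => ?_⟩
      · rw [linkValue_eq, linkValue_eq, hcap e e' he he',
          (hsame e e' he he').nodeValue_eq ih (hlt e he) (hlt e' he') μ hμ]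
      · rw [linkValue_eq] at hpos
        obtain ⟨h1, h2⟩ := lt_min_iff.1 hpos
        have h3 : ENNReal.ofReal (N.cap e - y) < ENNReal.ofReal (N.cap e - x) :=
          (ENNReal.ofReal_lt_ofReal_iff_of_nonneg (ENNReal.ofReal_pos.1 h1).le).2 (by linarith)
        rw [linkValue_eq, linkValue_eq]
        refine lt_min ((min_le_left _ _).trans_lt h3) ?_
        -- Into the destination the node value is constantly `⊤`; strictness then comes from the
        -- spare capacity alone.
        by_cases hl : N.head e = Fin.last n
        · rw [hl, nodeValue_last, nodeValue_last, min_eq_left le_top]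
          exact ENNReal.ofReal_lt_top
        · exact (min_le_right _ _).trans_lt ((ih _ (hlt e he)).nodeValue_strict hl hx hxy h2)

/-- The policy splits evenly whenever the links have positive value under the even split. -/
def IsEvenWherePositive (N : FlowNetwork n E) (G : RoutingMap n E) : Prop :=
  ∀ v, ∀ J ⊆ N.outLinks v, ∀ μ, 0 ≤ μ → ∀ e ∈ J, 0 < N.linkValue e (μ / J.card) →
    G v J μ e = μ / J.card

/-- A maximizer `x` does at least as well as the even split in the term of each `e`, and the rest of
that term is at most its even value. Cancelling gives `ℓ(μ / |J|) ≤ ℓ(x e)`, so no link exceeds the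
mean; as the mass is `μ`, all equal it. -/
theorem UniformAt.eq_even_of_mem_bpaArgmax {v : Fin (n + 1)} (hU : N.UniformAt v) {J : Finset E}
    (hJ : J ⊆ N.outLinks v) {r : E → ℝ} {μ : ℝ} (hμ : 0 ≤ μ) (hr : ∀ e ∈ J, r e ≤ μ / J.card)
    {e₀ : E} (he₀ : e₀ ∈ J) (hpos : 0 < N.linkValue e₀ (μ / J.card)) {x : E → ℝ}
    (hx : (feasibleSplits N.cap J r μ).Nonempty → x ∈ N.bpaArgmax v J r μ) :
    ∀ e ∈ J, x e = μ / J.card := by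
  have hne : J.Nonempty := ⟨e₀, he₀⟩
  have he₀v := mem_outLinks.1 (hJ he₀)
  have hC : μ / J.card < N.cap e₀ := by
    by_contra! h
    rw [linkValue_eq_zero h] at hpos
    exact lt_irrefl _ hpos
  have hfeas := even_mem_feasibleSplits (C := N.cap) hne hμ hr fun e he => by
    rw [hU.capEq e e₀ (mem_outLinks.1 (hJ he)) he₀v]
    exact hC.le
  obtain ⟨hxf, hmax⟩ := hx ⟨_, hfeas⟩
  have hobj : N.evenValue e₀ J.card μ ≤ N.bpaObjective v J μ x :=
    (hU.le_bpaObjective_even he₀v hμ J hJ fun e he r hr' =>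
      hU.le_bpaValue he₀v hμ _ ((Finset.erase_subset _ _).trans hJ) r hr').trans (hmax _ hfeas)
  have hle : ∀ e ∈ J, x e ≤ μ / J.card := by
    intro e he
    have het := mem_outLinks.1 (hJ he)
    have h1 := hobj.trans (iInf₂_le e he)
    have hc : J.card = (J.erase e).card + 1 := (Finset.card_erase_add_one he).symm
    rw [show N.evenValue e₀ J.card μ = N.evenValue e₀ (J.erase e).card μ
      + N.linkValue e₀ (μ / J.card) by rw [hc, evenValue_succ, ← hc], add_comm] at h1
    have h2 := h1.trans (add_le_add_right
      (hU.bpaValue_le he₀v hμ (J.erase e) ((Finset.erase_subset _ _).trans hJ) x) _)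
    have h3 := (ENNReal.add_le_add_iff_right (evenValue_ne_top _ _ _)).1 h2
    rw [hU.eq e₀ e he₀v het _ (by positivity)] at h3 hpos
    exact hU.le_of_linkValue_le het (by positivity) hpos h3
  refine (Finset.sum_eq_sum_iff_of_le hle).1 ?_
  have : (J.card : ℝ) ≠ 0 := by exact_mod_cast hne.card_ne_zero
  rw [hxf.2.2, Finset.sum_const, nsmul_eq_mul, mul_div_cancel₀ _ this]

theorem IsBPARouting.isEvenWherePositive {G : RoutingMap n E} (hBPA : N.IsBPARouting G)
    (hU : ∀ v, N.UniformAt v) : N.IsEvenWherePositive G := by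
  intro v J hJ μ hμ e he hpos
  have hv : v ≠ Fin.last n := mem_outLinks.1 (hJ he) ▸ N.tail_ne_last e
  have full : ∀ e ∈ N.outLinks v, 0 < N.linkValue e (μ / (N.outLinks v).card) →
      ∀ e ∈ N.outLinks v, G v (N.outLinks v) μ e = μ / (N.outLinks v).card :=
    fun e he hpos => (hU v).eq_even_of_mem_bpaArgmax subset_rfl hμ
      (fun _ _ => by simp only [Pi.zero_apply]; positivity) he hpos (hBPA v hv μ hμ).1
  rcases hJ.eq_or_ssubset with rfl | hss
  · exact full e he hpos e he
  · have hcard : μ / (N.outLinks v).card ≤ μ / J.card :=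
      div_le_div_of_nonneg_left hμ (by exact_mod_cast Finset.card_pos.2 ⟨e, he⟩)
        (by exact_mod_cast Finset.card_le_card hJ)
    -- Positivity passes to the smaller load of the full set, so `r*` is even and lies below the
    -- even split of `J`.
    have hpos' := hpos.trans_le ((hU v).anti (mem_outLinks.1 (hJ he)) (by positivity) hcard)
    exact (hU v).eq_even_of_mem_bpaArgmax hJ hμ
      (fun e' he' => (full e (hJ he) hpos' e' (hJ he')).trans_le hcard) he hpos
      ((hBPA v hv μ hμ).2 J hss ⟨e, he⟩) e he

end Values

/-! ### Tree structure and eventual stationarity -/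

section Dynamics

variable {n : ℕ} {E : Type*} [Fintype E] [DecidableEq E] {N : FlowNetwork n E}
  {lam : ℝ} {G : RoutingMap n E} {δ : ℕ → E → ℝ}

theorem activeOut_eq_filter (s : FlowState n E) (v : Fin (n + 1)) :
    N.activeOut s v = s.links.filter (fun e => N.tail e = v) := by
  ext e; simp [activeOut, mem_outLinks, and_comm]

theorem inLinks_inter_eq_filter (s : FlowState n E) (v : Fin (n + 1)) :
    N.inLinks v ∩ s.links = s.links.filter (fun e => N.head e = v) := by
  ext e; simp [mem_inLinks, and_comm]

theorem mem_activeOut {s : FlowState n E} {v : Fin (n + 1)} {e : E} :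
    e ∈ N.activeOut s v ↔ N.tail e = v ∧ e ∈ s.links := by
  simp [activeOut, mem_outLinks]

theorem activeOut_subset (s : FlowState n E) (v : Fin (n + 1)) :
    N.activeOut s v ⊆ N.outLinks v := Finset.inter_subset_left

theorem activeOut_mono {s s' : FlowState n E} (h : s.links ⊆ s'.links) (v : Fin (n + 1)) :
    N.activeOut s v ⊆ N.activeOut s' v := Finset.inter_subset_inter_left h

theorem inflow_zero (s : FlowState n E) : N.inflow lam s 0 = lam := by
  have : N.inLinks 0 = ∅ := Finset.eq_empty_of_forall_notMem fun e he =>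
    N.head_ne_zero e (mem_inLinks.1 he)
  simp [inflow, this]

/-- Every node other than the destination has at most one incoming link. -/
def HasUniqueInLinks (N : FlowNetwork n E) : Prop :=
  ∀ e e', N.head e ≠ Fin.last n → N.head e = N.head e' → e = e'

-- By counting: links not entering the destination inject into the edges of a tree, so there are at
-- most `|V| - 1` of them, while their heads cover all nodes of the tree other than the origin.
-- Hence the head map is injective on them.
omit [DecidableEq E] in
theorem IsDirectedTree.hasUniqueInLinks (h : N.IsDirectedTree) : N.HasUniqueInLinks := by
  classical
  let V := {v : Fin (n + 1) // v ≠ Fin.last n}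
  let A := {e : E // N.head e ≠ Fin.last n}
  let o : V := ⟨0, N.zero_ne_last⟩
  have hadj : ∀ a : A, N.underlyingGraph.Adj ⟨N.tail a, N.tail_ne_last a⟩ ⟨N.head a, a.2⟩ := by
    intro a
    rw [underlyingGraph, SimpleGraph.fromRel_adj]
    exact ⟨fun hh => (N.tail_lt_head a).ne (congrArg Subtype.val hh), Or.inl ⟨a, rfl, rfl⟩⟩
  let φ : A → N.underlyingGraph.edgeSet := fun a => ⟨s(_, _), hadj a⟩
  have hφ : Function.Injective φ := by
    intro a b hab
    have h1 := congrArg Subtype.val hab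
    simp only [φ, Sym2.eq_iff, Subtype.mk.injEq] at h1
    rcases h1 with ⟨h1, h2⟩ | ⟨h1, h2⟩
    · exact Subtype.ext (h.2 _ _ a.2 h1 h2)
    -- Two opposite links on one edge would contradict the topological order.
    · have ha := N.tail_lt_head a.1
      rw [h1, h2] at ha
      exact absurd ha (N.tail_lt_head b.1).not_gt
  let ψ : A → {v : V // v ≠ o} := fun a =>
    ⟨⟨N.head a, a.2⟩, fun hh => N.head_ne_zero a (congrArg Subtype.val hh)⟩
  have hψ : Function.Surjective ψ := by
    rintro ⟨⟨v, hv⟩, hv0⟩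
    obtain ⟨e, rfl⟩ := N.exists_in v fun hh => hv0 (Subtype.ext hh)
    exact ⟨⟨e, hv⟩, rfl⟩
  have hcard : Fintype.card A ≤ Fintype.card {v : V // v ≠ o} := by
    have h1 := Fintype.card_le_of_injective φ hφ
    have h2 := h.1.card_edgeFinset
    rw [SimpleGraph.edgeFinset_card] at h2
    have h3 : Fintype.card {v : V // v ≠ o} = Fintype.card V - 1 := by
      rw [Fintype.card_subtype_compl, Fintype.card_subtype_eq]
    change _ = Fintype.card V at h2
    omega
  have hinj : Function.Injective ψ :=
    (hψ.bijective_of_nat_card_le (by simpa only [Nat.card_eq_fintype_card] using hcard)).1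
  intro e e' he hee
  have := @hinj ⟨e, he⟩ ⟨e', hee ▸ he⟩ (Subtype.ext (Subtype.ext hee))
  exact congrArg Subtype.val this

theorem HasUniqueInLinks.inflow_head (h : N.HasUniqueInLinks) {s : FlowState n E} {e : E}
    (he : e ∈ s.links) (hl : N.head e ≠ Fin.last n) : N.inflow lam s (N.head e) = s.flow e := by
  have : N.inLinks (N.head e) ∩ s.links = {e} := by
    ext e'
    simp only [Finset.mem_inter, mem_inLinks, Finset.mem_singleton]
    exact ⟨fun h' => (h e e' hl h'.1.symm).symm, by rintro rfl; exact ⟨rfl, he⟩⟩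
  rw [inflow, if_neg (N.head_ne_zero e), this, Finset.sum_singleton, zero_add]

/-- A state of which the dynamics without disturbance changes neither links nor nodes nor flow. -/
structure IsSettled (N : FlowNetwork n E) (lam : ℝ) (G : RoutingMap n E) (s : FlowState n E) :
    Prop where
  flow_lt : ∀ e ∈ s.links, s.flow e < s.rescap e
  head_mem : ∀ e ∈ s.links, N.head e = Fin.last n ∨ N.head e ∈ s.nodes
  out_nonempty : ∀ v ∈ s.nodes, (N.activeOut s v).Nonempty
  flow_eq : ∀ e ∈ s.links,
    s.flow e = G (N.tail e) (N.activeOut s (N.tail e)) (N.inflow lam s (N.tail e)) e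
  flow_eq_zero : ∀ e ∉ s.links, s.flow e = 0

theorem isSettled_of_step_eq {d : E → ℝ} {s : FlowState n E}
    (hlinks : (N.step lam G d s).links = s.links) (hnodes : (N.step lam G d s).nodes = s.nodes)
    (hflow : (N.step lam G d s).flow = s.flow) : N.IsSettled lam G s := by
  refine ⟨fun e he => ?_, fun e he => ?_, fun v hv => ?_, fun e he => ?_, fun e he => ?_⟩
  · rw [← hlinks] at he
    exact (Finset.mem_filter.1 he).2.1
  · rw [← hlinks] at he
    exact (Finset.mem_filter.1 he).2.2
  · rw [← hnodes] at hv
    exact (Finset.mem_filter.1 hv).2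
  · conv_lhs => rw [← hflow]
    exact if_pos he
  · conv_lhs => rw [← hflow]
    exact if_neg he

theorem IsSettled.head_nonempty {s : FlowState n E} (hs : N.IsSettled lam G s) {e : E}
    (he : e ∈ s.links) (hl : N.head e ≠ Fin.last n) : (N.activeOut s (N.head e)).Nonempty :=
  hs.out_nonempty _ ((hs.head_mem e he).resolve_left hl)

section Trajectory

variable (N lam G δ)

theorem links_antitone : Antitone fun t => (N.state lam G δ t).links :=
  antitone_nat_of_succ_le fun _ => Finset.filter_subset _ _

theorem nodes_antitone : Antitone fun t => (N.state lam G δ t).nodes :=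
  antitone_nat_of_succ_le fun _ => Finset.filter_subset _ _

theorem rescap_state (t : ℕ) (e : E) :
    (N.state lam G δ t).rescap e = N.cap e - ∑ s ∈ Finset.range t, δ (s + 1) e := by
  induction t with
  | zero => simp [state, initialState]
  | succ t ih =>
    change (N.state lam G δ t).rescap e - δ (t + 1) e = _
    rw [ih, Finset.sum_range_succ]; ring

theorem activeOut_eq_empty_of_notMem_nodes (t : ℕ) {v : Fin (n + 1)} (hv : v ≠ Fin.last n)
    (h : v ∉ (N.state lam G δ t).nodes) : N.activeOut (N.state lam G δ t) v = ∅ := by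
  induction t with
  | zero => simp [state, initialState, hv] at h
  | succ t ih =>
    refine Finset.subset_empty.1
      ((activeOut_mono (N.links_antitone lam G δ (Nat.le_succ t)) v).trans ?_)
    by_cases h' : v ∈ (N.state lam G δ t).nodes
    · by_contra hne
      refine h (Finset.mem_filter.2 ⟨h', Finset.nonempty_iff_ne_empty.2 fun h0 => hne ?_⟩)
      rw [h0]
    · rw [ih h']

theorem inflow_initialState (v : Fin (n + 1)) :
    N.inflow lam (N.initialState lam G) v = N.initialInflow lam G v := by
  rw [initialInflow, inflow]
  congr 1
  simp only [initialState, Finset.inter_univ]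
  exact (Finset.sum_subtype _ (fun e => mem_inLinks) _)

/-- The flow on an active link comes from routing an inflow that the tail had at the same time or just
before. -/
theorem exists_flow_eq (t : ℕ) {e : E} (he : e ∈ (N.state lam G δ t).links) :
    ∃ t' ≤ t, (N.state lam G δ t).flow e =
      G (N.tail e) (N.activeOut (N.state lam G δ t') (N.tail e))
        (N.inflow lam (N.state lam G δ t') (N.tail e)) e := by
  cases t with
  | zero =>
    refine ⟨0, le_rfl, ?_⟩
    simp only [state, inflow_initialState]
    simp [activeOut, initialState]
  | succ t =>
    exact ⟨t, Nat.le_succ t, if_pos (N.links_antitone lam G δ (Nat.le_succ t) he)⟩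

theorem eventually_const_of_antitone {α : Type*} {u : ℕ → Finset α} (hu : Antitone u) :
    ∃ a, ∀ᶠ t in atTop, u t = a := by
  obtain ⟨T, hT⟩ := WellFoundedLT.antitone_chain_condition hu
  exact ⟨u T, eventually_atTop.2 ⟨T, fun t ht => (hT t ht).symm⟩⟩

/-- Links and nodes decrease, so they stabilize; the flow then stabilizes along the topological
order. -/
theorem exists_eventually_eq : ∃ T, ∀ t ≥ T,
    (N.state lam G δ t).links = (N.state lam G δ T).links ∧
    (N.state lam G δ t).nodes = (N.state lam G δ T).nodes ∧
    (N.state lam G δ t).flow = (N.state lam G δ T).flow := by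
  obtain ⟨L, hL⟩ := eventually_const_of_antitone (N.links_antitone lam G δ)
  obtain ⟨V, hV⟩ := eventually_const_of_antitone (N.nodes_antitone lam G δ)
  have hflow : ∀ v, ∀ e, N.tail e = v →
      ∃ a, ∀ᶠ t in atTop, (N.state lam G δ t).flow e = a := by
    intro v
    induction v using WellFoundedLT.induction with
    | ind v ih =>
      intro e he
      have h1 : ∀ e', ∃ a, N.head e' = v → ∀ᶠ t in atTop, (N.state lam G δ t).flow e' = a := by
        intro e'
        by_cases h : N.head e' = v
        · obtain ⟨a, ha⟩ := ih (N.tail e') (h ▸ N.tail_lt_head e') e' rfl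
          exact ⟨a, fun _ => ha⟩
        · exact ⟨0, fun h' => absurd h' h⟩
      choose a ha using h1
      have h2 : ∀ᶠ t in atTop, ∀ e', N.head e' = v → (N.state lam G δ t).flow e' = a e' :=
        eventually_all.2 fun e' => by
          by_cases h : N.head e' = v
          · exact (ha e' h).mono fun t ht _ => ht
          · exact Eventually.of_forall fun t h' => absurd h' h
      refine ⟨if e ∈ L then G v (N.outLinks v ∩ L)
        ((if v = 0 then lam else 0) + ∑ e' ∈ N.inLinks v ∩ L, a e') e else 0, ?_⟩
      obtain ⟨T, hT⟩ := eventually_atTop.1 (hL.and h2)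
      -- Flow lags one step behind the inflow that it routes.
      refine eventually_atTop.2 ⟨T + 1, fun t ht => ?_⟩
      obtain ⟨t, rfl⟩ := Nat.exists_eq_add_of_le' (Nat.one_le_of_lt ht)
      obtain ⟨ht1, ht2⟩ := hT t (Nat.le_of_succ_le_succ ht)
      change (if e ∈ (N.state lam G δ t).links then _ else _) = _
      rw [he, activeOut, inflow, ht1]
      congr 3
      exact Finset.sum_congr rfl fun e' he' => ht2 e' (mem_inLinks.1 (Finset.mem_inter.1 he').1)
  choose f hf using fun e => hflow _ e rfl
  obtain ⟨T, hT⟩ := eventually_atTop.1 ((hL.and hV).and (eventually_all.2 hf))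
  refine ⟨T, fun t ht => ⟨?_, ?_, ?_⟩⟩
  · rw [(hT t ht).1.1, (hT T le_rfl).1.1]
  · rw [(hT t ht).1.2, (hT T le_rfl).1.2]
  · funext e
    rw [(hT t ht).2 e, (hT T le_rfl).2 e]

/-- From time `T` on, links, nodes and flow do not change. -/
def SettledFrom (T : ℕ) : Prop := ∀ t ≥ T,
    (N.state lam G δ t).links = (N.state lam G δ T).links ∧
    (N.state lam G δ t).nodes = (N.state lam G δ T).nodes ∧
    (N.state lam G δ t).flow = (N.state lam G δ T).flow

theorem exists_settledFrom (T₀ : ℕ) : ∃ T ≥ T₀, N.SettledFrom lam G δ T := by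
  obtain ⟨T, hT⟩ := N.exists_eventually_eq lam G δ
  refine ⟨max T₀ T, le_max_left _ _, fun t ht => ?_⟩
  obtain ⟨h1, h2, h3⟩ := hT t ((le_max_right _ _).trans ht)
  obtain ⟨h1', h2', h3'⟩ := hT (max T₀ T) (le_max_right _ _)
  exact ⟨h1.trans h1'.symm, h2.trans h2'.symm, h3.trans h3'.symm⟩

variable {N lam G δ}

theorem SettledFrom.isSettled {T : ℕ} (h : N.SettledFrom lam G δ T) :
    N.IsSettled lam G (N.state lam G δ T) :=
  let ⟨h1, h2, h3⟩ := h (T + 1) (Nat.le_succ T)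
  isSettled_of_step_eq h1 h2 h3

end Trajectory

/-! ### Flow balance: transfer depends only on the origin keeping a link -/

section Conservation

variable (hG : N.IsRoutingPolicy G)
include hG

theorem IsRoutingPolicy.flow_nonneg_and_inflow_nonneg (hlam : 0 ≤ lam) (t : ℕ) :
    (∀ e ∈ (N.state lam G δ t).links, 0 ≤ (N.state lam G δ t).flow e) ∧
      ∀ v, 0 ≤ N.inflow lam (N.state lam G δ t) v := by
  induction t using Nat.strong_induction_on with
  | _ t ih =>
    have key : ∀ v, (∀ e ∈ (N.state lam G δ t).links, N.tail e = v →
        0 ≤ (N.state lam G δ t).flow e) ∧ 0 ≤ N.inflow lam (N.state lam G δ t) v := by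
      intro v
      -- At time `0` the flow routes the simultaneous inflow, so induction on time needs an inner
      -- one along the topological order.
      induction v using WellFoundedLT.induction with
      | ind v ihv =>
        have hin : 0 ≤ N.inflow lam (N.state lam G δ t) v := by
          refine add_nonneg (by split_ifs <;> simp [hlam]) (Finset.sum_nonneg fun e he => ?_)
          rw [Finset.mem_inter, mem_inLinks] at he
          exact (ihv (N.tail e) (he.1 ▸ N.tail_lt_head e)).1 e he.2 rfl
        refine ⟨?_, hin⟩
        rintro e he rfl
        obtain ⟨t', ht', heq⟩ := N.exists_flow_eq lam G δ t he
        have hmem : e ∈ N.activeOut (N.state lam G δ t') (N.tail e) :=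
          mem_activeOut.2 ⟨rfl, N.links_antitone lam G δ ht' he⟩
        rw [heq]
        refine (hG _ (N.tail_ne_last e) _ (activeOut_subset _ _) ⟨e, hmem⟩ _ ?_).1 e
        rcases ht'.eq_or_lt with rfl | hlt
        · exact hin
        · exact (ih t' hlt).2 _
    exact ⟨fun e he => (key _).1 e he rfl, fun v => (key v).2⟩

theorem IsRoutingPolicy.flow_nonneg (hlam : 0 ≤ lam) {t : ℕ} {e : E}
    (he : e ∈ (N.state lam G δ t).links) : 0 ≤ (N.state lam G δ t).flow e :=
  (hG.flow_nonneg_and_inflow_nonneg hlam t).1 e he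

theorem IsRoutingPolicy.inflow_nonneg (hlam : 0 ≤ lam) (t : ℕ) (v : Fin (n + 1)) :
    0 ≤ N.inflow lam (N.state lam G δ t) v :=
  (hG.flow_nonneg_and_inflow_nonneg hlam t).2 v

theorem IsSettled.sum_flow {s : FlowState n E} (hs : N.IsSettled lam G s) {v : Fin (n + 1)}
    (hv : v ≠ Fin.last n) (hne : (N.activeOut s v).Nonempty) (hin : 0 ≤ N.inflow lam s v) :
    ∑ e ∈ N.activeOut s v, s.flow e = N.inflow lam s v := by
  rw [← (hG v hv _ (activeOut_subset s v) hne _ hin).2.2]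
  refine Finset.sum_congr rfl fun e he => ?_
  obtain ⟨rfl, he'⟩ := mem_activeOut.1 he
  exact hs.flow_eq e he'

/-- In the settled state every node but the destination is balanced, including failed ones, which
receive nothing. Summing over all nodes, the link flows cancel and the destination is left with
`lam`. -/
theorem isTransferring_of_forall_nonempty (hlam : 0 ≤ lam)
    (h : ∀ t, (N.activeOut (N.state lam G δ t) 0).Nonempty) : N.IsTransferring lam G δ := by
  obtain ⟨T, -, hT⟩ := N.exists_settledFrom lam G δ 0
  have hs := hT.isSettled
  set s := N.state lam G δ T with hsdef
  refine tendsto_atTop_of_eventually_const (i₀ := T) fun t ht => ?_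
  rw [(hT t ht).2.2, ← hsdef]
  have hbal : ∀ v ∈ Finset.univ.erase (Fin.last n),
      ∑ e ∈ N.activeOut s v, s.flow e = N.inflow lam s v := by
    intro v hv
    have hv := Finset.ne_of_mem_erase hv
    by_cases hne : (N.activeOut s v).Nonempty
    · exact hs.sum_flow hG hv hne (hG.inflow_nonneg hlam _ _)
    · have h0 : v ≠ 0 := by rintro rfl; exact hne (h T)
      have hin : N.inLinks v ∩ s.links = ∅ := Finset.eq_empty_of_forall_notMem fun e he => by
        rw [Finset.mem_inter, mem_inLinks] at he
        obtain ⟨rfl, he⟩ := he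
        exact hne (hs.head_nonempty he hv)
      rw [Finset.not_nonempty_iff_eq_empty.1 hne, inflow, if_neg h0, hin]
      simp
  have hsum := Finset.sum_congr rfl hbal
  have hout : N.activeOut s (Fin.last n) = ∅ := Finset.eq_empty_of_forall_notMem fun e he =>
    N.tail_ne_last e (mem_activeOut.1 he).1
  have e1 : ∑ v, ∑ e ∈ N.activeOut s v, s.flow e = ∑ e ∈ s.links, s.flow e := by
    simp only [activeOut_eq_filter]
    exact Finset.sum_fiberwise _ _ _
  have e2 : ∑ v, N.inflow lam s v = lam + ∑ e ∈ s.links, s.flow e := by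
    simp only [inflow, inLinks_inter_eq_filter, Finset.sum_add_distrib]
    rw [Finset.sum_fiberwise, Finset.sum_ite_eq' Finset.univ (0 : Fin (n + 1)), if_pos (Finset.mem_univ _)]
  rw [← Finset.add_sum_erase _ _ (Finset.mem_univ (Fin.last n)), hout, Finset.sum_empty] at e1
  rw [← Finset.add_sum_erase _ _ (Finset.mem_univ (Fin.last n))] at e2
  have e3 : N.inflow lam s (Fin.last n) = ∑ e ∈ N.inLinks (Fin.last n), s.flow e := by
    rw [inflow, if_neg N.zero_ne_last.symm, zero_add]
    refine Finset.sum_subset Finset.inter_subset_left fun e he hne => hs.flow_eq_zero e fun h' => ?_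
    exact hne (Finset.mem_inter.2 ⟨he, h'⟩)
  linarith

/-- Once the origin is cut off, the settled flow vanishes node by node in topological order, since
nonnegative flows with sum zero are zero. -/
theorem not_isTransferring_of_activeOut_eq_empty (hlam : 0 < lam) {t : ℕ}
    (h : N.activeOut (N.state lam G δ t) 0 = ∅) : ¬ N.IsTransferring lam G δ := by
  obtain ⟨T, hTt, hT⟩ := N.exists_settledFrom lam G δ t
  have hs := hT.isSettled
  have h0 : N.activeOut (N.state lam G δ T) 0 = ∅ :=
    Finset.subset_empty.1 (h ▸ activeOut_mono (N.links_antitone lam G δ hTt) 0)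
  set s := N.state lam G δ T with hsdef
  have hzero : ∀ v, ∀ e, N.tail e = v → s.flow e = 0 := by
    intro v
    induction v using WellFoundedLT.induction with
    | ind v ih =>
      rintro e rfl
      by_cases he : e ∈ s.links
      · have hmem : e ∈ N.activeOut s (N.tail e) := mem_activeOut.2 ⟨rfl, he⟩
        have hv0 : N.tail e ≠ 0 := by
          intro h'
          rw [h', h0] at hmem
          simp at hmem
        have hin : N.inflow lam s (N.tail e) = 0 := by
          rw [inflow, if_neg hv0, zero_add]
          refine Finset.sum_eq_zero fun e' he' => ?_
          rw [Finset.mem_inter, mem_inLinks] at he'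
          exact ih (N.tail e') (he'.1 ▸ N.tail_lt_head e') e' rfl
        have hsum := hs.sum_flow hG (N.tail_ne_last e) ⟨e, hmem⟩ hin.ge
        rw [hin] at hsum
        refine (Finset.sum_eq_zero_iff_of_nonneg fun e' he' => ?_).1 hsum e hmem
        exact hG.flow_nonneg hlam.le (mem_activeOut.1 he').2
      · exact hs.flow_eq_zero e he
  intro htr
  have : Tendsto (fun t => ∑ e ∈ N.inLinks (Fin.last n), (N.state lam G δ t).flow e) atTop
      (𝓝 0) := by
    refine tendsto_atTop_of_eventually_const (i₀ := T) fun t ht => ?_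
    rw [(hT t ht).2.2, ← hsdef]
    exact Finset.sum_eq_zero fun e _ => hzero _ e rfl
  exact hlam.ne' (tendsto_nhds_unique htr this)

end Conservation

end Dynamics

/-! ### Failure of the origin costs at least its value -/

section LowerBound

variable {n : ℕ} {E : Type*} [Fintype E] [DecidableEq E] {N : FlowNetwork n E}
  {lam : ℝ} {G : RoutingMap n E} {δ : ℕ → E → ℝ}

/-- The total of `D` over the links below `v`. -/
noncomputable def subtreeDamage (N : FlowNetwork n E) (D : E → ℝ≥0∞) (v : Fin (n + 1)) : ℝ≥0∞ :=
  ∑ e : {e : E // N.tail e = v}, (D e.1 + subtreeDamage N D (N.head e.1))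
termination_by n - v.val
decreasing_by
  have h := N.tail_lt_head e.1
  rw [e.2] at h
  have := (N.head e.1).isLt
  have : v.val < (N.head e.1).val := h
  omega

omit [DecidableEq E] in
theorem subtreeDamage_eq (D : E → ℝ≥0∞) (v : Fin (n + 1)) :
    N.subtreeDamage D v = ∑ e ∈ N.outLinks v, (D e + N.subtreeDamage D (N.head e)) := by
  rw [subtreeDamage]
  exact (Finset.sum_subtype _ (fun e => mem_outLinks)
    fun e => D e + N.subtreeDamage D (N.head e)).symm

omit [DecidableEq E] in
theorem subtreeDamage_last (D : E → ℝ≥0∞) : N.subtreeDamage D (Fin.last n) = 0 := by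
  rw [subtreeDamage_eq]
  exact Finset.sum_eq_zero fun e he => absurd (mem_outLinks.1 he) (N.tail_ne_last e)

omit [DecidableEq E] in
theorem subtreeDamage_ne_top {D : E → ℝ≥0∞} (hD : ∀ e, D e ≠ ⊤) (v : Fin (n + 1)) :
    N.subtreeDamage D v ≠ ⊤ := by
  induction v using WellFoundedGT.induction with
  | ind v ih =>
    rw [subtreeDamage_eq]
    refine ENNReal.sum_ne_top.2 fun e he => ENNReal.add_ne_top.2 ⟨hD e, ih _ ?_⟩
    exact mem_outLinks.1 he ▸ N.tail_lt_head e

/-- Sum the recursion over all nodes: every node other than the origin and the destination is the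
head of at most one link, so the terms of the heads cancel, which needs finiteness. -/
theorem HasUniqueInLinks.subtreeDamage_zero_le (h : N.HasUniqueInLinks) {D : E → ℝ≥0∞}
    (hD : ∀ e, D e ≠ ⊤) : N.subtreeDamage D 0 ≤ ∑ e, D e := by
  have h1 : ∑ v, N.subtreeDamage D v = ∑ e, D e + ∑ e, N.subtreeDamage D (N.head e) := by
    rw [← Finset.sum_add_distrib, ← Finset.sum_fiberwise Finset.univ N.tail]
    exact Finset.sum_congr rfl fun v _ => subtreeDamage_eq D v
  have h2 : ∑ e, N.subtreeDamage D (N.head e) ≤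
      ∑ v ∈ Finset.univ.erase 0, N.subtreeDamage D v := by
    rw [← Finset.sum_fiberwise Finset.univ N.head, ← Finset.add_sum_erase _ _ (Finset.mem_univ 0)]
    have h0 : (Finset.univ.filter fun e => N.head e = 0) = ∅ :=
      Finset.filter_eq_empty_iff.2 fun e _ => N.head_ne_zero e
    rw [h0, Finset.sum_empty, zero_add]
    refine Finset.sum_le_sum fun v _ => ?_
    rw [Finset.sum_congr rfl fun e he => by rw [(Finset.mem_filter.1 he).2], Finset.sum_const]
    by_cases hv : v = Fin.last n
    · rw [hv, subtreeDamage_last, smul_zero]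
    · have hc : (Finset.univ.filter fun e => N.head e = v).card ≤ 1 :=
        Finset.card_le_one.2 fun a ha b hb => by
          rw [Finset.mem_filter] at ha hb
          exact h a b (ha.2.trans_ne hv) (ha.2.trans hb.2.symm)
      calc _ ≤ 1 • N.subtreeDamage D v := nsmul_le_nsmul_left zero_le hc
        _ = _ := one_nsmul _
  rw [← Finset.add_sum_erase _ _ (Finset.mem_univ 0)] at h1
  refine (ENNReal.add_le_add_iff_right (ENNReal.sum_ne_top.2 fun v _ =>
    subtreeDamage_ne_top hD v : ∑ v ∈ Finset.univ.erase 0, N.subtreeDamage D v ≠ ⊤)).1 ?_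
  rw [h1]
  gcongr

/-- Losing `b` links at once is no cheaper than losing them one after another, when the survivors
carry more. -/
theorem UniformAt.evenValue_add_le {v : Fin (n + 1)} (hU : N.UniformAt v) {e : E}
    (he : N.tail e = v) {μ : ℝ} (hμ : 0 ≤ μ) (a b : ℕ) :
    N.evenValue e (a + b) μ ≤ N.evenValue e a μ + b • N.linkValue e (μ / (a + b : ℕ)) := by
  rw [evenValue, Finset.sum_range_add]
  refine add_le_add le_rfl ?_
  refine (Finset.sum_le_card_nsmul _ _ _ fun i hi => ?_).trans_eq (by rw [Finset.card_range])
  rw [Finset.mem_range] at hi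
  refine hU.anti he (by positivity) (div_le_div_of_nonneg_left hμ (by positivity) ?_)
  exact_mod_cast by omega

section

variable (hG : N.IsRoutingPolicy G) (hE : N.IsEvenWherePositive G) (hU : ∀ v, N.UniformAt v)
  (hlam : 0 ≤ lam)
include hG hE hU hlam

/-- Earlier there were at least as many active links, so the even share was no larger; by
monotonicity its value was positive too, so the policy did split evenly. -/
theorem IsEvenWherePositive.flow_le {t s : ℕ} (hst : s ≤ t) {e : E}
    (he : e ∈ (N.state lam G δ t).links) {μ : ℝ}
    (hμ : ∀ s ≤ t, N.inflow lam (N.state lam G δ s) (N.tail e) ≤ μ)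
    (hpos : 0 < N.linkValue e (μ / (N.activeOut (N.state lam G δ t) (N.tail e)).card)) :
    (N.state lam G δ s).flow e ≤ μ / (N.activeOut (N.state lam G δ t) (N.tail e)).card := by
  obtain ⟨s', hs', heq⟩ := N.exists_flow_eq lam G δ s (N.links_antitone lam G δ hst he)
  have hin := hG.inflow_nonneg (δ := δ) hlam s' (N.tail e)
  have hmem : e ∈ N.activeOut (N.state lam G δ t) (N.tail e) := mem_activeOut.2 ⟨rfl, he⟩
  have hsub := activeOut_mono (N := N) (N.links_antitone lam G δ (hs'.trans hst)) (N.tail e)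
  have hle : N.inflow lam (N.state lam G δ s') (N.tail e) /
      (N.activeOut (N.state lam G δ s') (N.tail e)).card ≤
      μ / (N.activeOut (N.state lam G δ t) (N.tail e)).card :=
    div_le_div₀ (hin.trans (hμ s' (hs'.trans hst))) (hμ s' (hs'.trans hst))
      (by exact_mod_cast Finset.card_pos.2 ⟨e, hmem⟩) (by exact_mod_cast Finset.card_le_card hsub)
  rw [heq, hE _ _ (activeOut_subset _ _) _ hin e (hsub hmem)
    (hpos.trans_le ((hU _).anti rfl (by positivity) hle))]
  exact hle

/-- A node whose inflow never exceeds `μ` only fails after damage of at least its value below it. -/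
theorem IsEvenWherePositive.nodeValue_le_subtreeDamage (huniq : N.HasUniqueInLinks)
    (hδ : N.IsDisturbance δ) (v : Fin (n + 1)) :
    ∀ T μ, v ≠ Fin.last n → (∀ t ≤ T, N.inflow lam (N.state lam G δ t) v ≤ μ) →
      N.activeOut (N.state lam G δ T) v = ∅ →
      N.nodeValue v μ ≤ N.subtreeDamage (fun e => ∑' t, ENNReal.ofReal (δ (t + 1) e)) v := by
  set D : E → ℝ≥0∞ := fun e => ∑' t, ENNReal.ofReal (δ (t + 1) e) with hD
  induction v using WellFoundedGT.induction with
  | ind v ih =>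
    intro T μ hv hμ hdead
    have hμ0 : 0 ≤ μ := (hG.inflow_nonneg (δ := δ) hlam 0 v).trans (hμ 0 (Nat.zero_le T))
    -- A lost link was overloaded, and then the damage on it is at least `cap - μ / k`, or its head
    -- had failed with inflow at most `μ / k` throughout, and induction applies to the head.
    have fail : ∀ t < T, ∀ e, N.tail e = v → e ∈ (N.state lam G δ t).links →
        e ∉ (N.state lam G δ (t + 1)).links →
        N.linkValue e (μ / (N.activeOut (N.state lam G δ t) v).card) ≤
          D e + N.subtreeDamage D (N.head e) := by
      rintro t ht e rfl he hne
      rcases eq_zero_or_pos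
        (N.linkValue e (μ / (N.activeOut (N.state lam G δ t) (N.tail e)).card)) with h0 | hpos
      · rw [h0]; exact zero_le
      have hflow : ∀ s ≤ t, _ := fun s hs => hE.flow_le hG hU hlam hs he
        (fun s hs => hμ s (hs.trans ht.le)) hpos
      by_cases hover : (N.state lam G δ t).flow e < (N.state lam G δ t).rescap e
      · have hhead : ¬ (N.head e = Fin.last n ∨ N.head e ∈ (N.state lam G δ t).nodes) :=
          fun hh => hne (Finset.mem_filter.2 ⟨he, hover, hh⟩)
        push Not at hhead
        refine (min_le_right _ _).trans (le_add_left ?_)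
        refine ih _ (N.tail_lt_head e) t _ hhead.1 (fun s hs => ?_)
          (N.activeOut_eq_empty_of_notMem_nodes lam G δ t hhead.1 hhead.2)
        rw [huniq.inflow_head (N.links_antitone lam G δ hs he) hhead.1]
        exact hflow s hs
      · rw [not_lt, rescap_state] at hover
        refine (min_le_left _ _).trans (le_add_right ?_)
        have := hflow t le_rfl
        calc _ ≤ ENNReal.ofReal (∑ s ∈ Finset.range t, δ (s + 1) e) :=
              ENNReal.ofReal_le_ofReal (by linarith)
          _ = ∑ s ∈ Finset.range t, ENNReal.ofReal (δ (s + 1) e) :=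
              ENNReal.ofReal_sum_of_nonneg fun s _ => hδ.1 s e
          _ ≤ D e := ENNReal.sum_le_tsum _
    obtain ⟨e₀, he₀⟩ := N.exists_out v hv
    -- Invariant: damage charged to the lost links plus the even value of the surviving ones covers
    -- the value of `v`.
    have main : ∀ t ≤ T, N.evenValue e₀ (N.outLinks v).card μ ≤
        ∑ e ∈ N.outLinks v \ N.activeOut (N.state lam G δ t) v,
          (D e + N.subtreeDamage D (N.head e)) +
        N.evenValue e₀ (N.activeOut (N.state lam G δ t) v).card μ := by
      intro t
      induction t with
      | zero =>
        intro _
        refine le_add_left (le_of_eq ?_)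
        simp [state, initialState, activeOut]
      | succ t iht =>
        intro ht
        refine (iht (Nat.le_of_succ_le ht)).trans ?_
        set a := N.activeOut (N.state lam G δ t) v with ha
        set b := N.activeOut (N.state lam G δ (t + 1)) v with hb
        have hba : b ⊆ a := activeOut_mono (N.links_antitone lam G δ (Nat.le_succ t)) v
        have hao : a ⊆ N.outLinks v := activeOut_subset _ _
        have hsplit : N.outLinks v \ b = (N.outLinks v \ a) ∪ (a \ b) := by
          ext e
          have := @hba e
          have := @hao e
          simp only [Finset.mem_sdiff, Finset.mem_union]
          tauto
        have hdisj : Disjoint (N.outLinks v \ a) (a \ b) :=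
          Finset.sdiff_disjoint.mono_right Finset.sdiff_subset
        rw [hsplit, Finset.sum_union hdisj, add_assoc]
        refine add_le_add le_rfl ?_
        have hcard : a.card = b.card + (a \ b).card := by
          rw [add_comm, Finset.card_sdiff_add_card_eq_card hba]
        rw [add_comm]
        calc N.evenValue e₀ a.card μ
            ≤ N.evenValue e₀ b.card μ + (a \ b).card • N.linkValue e₀ (μ / a.card) := by
              have := (hU v).evenValue_add_le he₀ hμ0 b.card (a \ b).card
              rwa [← hcard] at this
          _ ≤ _ := by
              refine add_le_add le_rfl (Finset.card_nsmul_le_sum _ _ _ fun e he => ?_)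
              rw [Finset.mem_sdiff, ha, hb, mem_activeOut, mem_activeOut] at he
              rw [(hU v).eq e₀ e he₀ he.1.1 _ (by positivity)]
              exact fail t ht e he.1.1 he.1.2 fun h' => he.2 ⟨he.1.1, h'⟩
    have := main T le_rfl
    rw [hdead] at this
    rw [(hU v).nodeValue_eq he₀ hμ0, subtreeDamage_eq]
    simpa [evenValue] using this

theorem IsEvenWherePositive.isTransferring (huniq : N.HasUniqueInLinks)
    (hδ : N.IsDisturbance δ) (hlt : disturbanceMagnitude δ < N.bpaBound lam) :
    N.IsTransferring lam G δ := by
  refine isTransferring_of_forall_nonempty hG hlam fun T => ?_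
  by_contra hdead
  refine hlt.not_ge ?_
  have h1 := hE.nodeValue_le_subtreeDamage hG hU hlam huniq hδ 0 T lam N.zero_ne_last
    (fun t _ => (inflow_zero _).le) (Finset.not_nonempty_iff_eq_empty.1 hdead)
  refine h1.trans (huniq.subtreeDamage_zero_le fun e => ?_)
  exact ENNReal.sum_ne_top.1 hlt.ne_top e (Finset.mem_univ e)

theorem IsEvenWherePositive.bpaBound_le_resilience (huniq : N.HasUniqueInLinks) :
    N.bpaBound lam ≤ N.resilience lam G :=
  le_iInf fun _ => le_iInf fun hδ => le_iInf fun hnot =>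
    not_lt.1 fun hlt => hnot (hE.isTransferring hG hU hlam huniq hδ hlt)

end

end LowerBound

/-! ### An attack that costs at most the value, against any routing policy -/

section UpperBound

variable {n : ℕ} {E : Type*} [Fintype E] [DecidableEq E] {N : FlowNetwork n E}
  {lam : ℝ} {G : RoutingMap n E} {δ : ℕ → E → ℝ}

/-- `N.AttackCost lam s v b`: in the state `s` the attacker can make `v` fail at cost at most `b`, by
removing one link below `v` and then the remaining links leaving `v` at the cost of even splits. -/
inductive AttackCost (N : FlowNetwork n E) (lam : ℝ) (s : FlowState n E) :
    Fin (n + 1) → ℝ≥0∞ → Prop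
  | direct (e : E) (he : e ∈ s.links) : AttackCost N lam s (N.tail e)
      (ENNReal.ofReal (s.rescap e - s.flow e) +
        N.evenValue e ((N.activeOut s (N.tail e)).card - 1) (N.inflow lam s (N.tail e)))
  | child (e : E) (he : e ∈ s.links) (b : ℝ≥0∞) (hb : AttackCost N lam s (N.head e) b) :
      AttackCost N lam s (N.tail e)
        (b + N.evenValue e ((N.activeOut s (N.tail e)).card - 1) (N.inflow lam s (N.tail e)))

theorem AttackCost.ne_last {s : FlowState n E} {v : Fin (n + 1)} {b : ℝ≥0∞}
    (h : N.AttackCost lam s v b) : v ≠ Fin.last n := by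
  cases h <;> exact N.tail_ne_last _

/-- Choose a link loaded with at least the mean. The cheaper of exhausting it and making its head
fail costs at most `ℓ(μ / k)`, the top summand of the even value; the other summands are held back
for the remaining links. -/
theorem IsSettled.exists_attackCost (hG : N.IsRoutingPolicy G) (hU : ∀ v, N.UniformAt v)
    (huniq : N.HasUniqueInLinks) {s : FlowState n E} (hs : N.IsSettled lam G s)
    (hcap : ∀ e, s.rescap e ≤ N.cap e) (hin : ∀ v, 0 ≤ N.inflow lam s v) (v : Fin (n + 1)) :
    v ≠ Fin.last n → (N.activeOut s v).Nonempty → ∃ b, N.AttackCost lam s v b ∧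
      ∀ e, N.tail e = v → b ≤ N.evenValue e (N.activeOut s v).card (N.inflow lam s v) := by
  induction v using WellFoundedGT.induction with
  | ind v ih =>
    intro hv hne
    obtain ⟨e, heJ, hle⟩ := UniformAt.exists_even_le_of_sum hne (hs.sum_flow hG hv hne (hin v))
    obtain ⟨rfl, he⟩ := mem_activeOut.1 heJ
    have hpos := hin (N.tail e)
    have hbound : ∀ b, b ≤ N.linkValue e (s.flow e) → ∀ e', N.tail e' = N.tail e →
        b + N.evenValue e ((N.activeOut s (N.tail e)).card - 1) (N.inflow lam s (N.tail e)) ≤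
        N.evenValue e' (N.activeOut s (N.tail e)).card (N.inflow lam s (N.tail e)) := by
      intro b hb e' he'
      have hsame : N.evenValue e' (N.activeOut s (N.tail e)).card (N.inflow lam s (N.tail e)) =
          N.evenValue e (N.activeOut s (N.tail e)).card (N.inflow lam s (N.tail e)) :=
        Finset.sum_congr rfl fun i _ => (hU _).eq e' e he' rfl _ (by positivity)
      obtain ⟨k, hk⟩ := Nat.exists_eq_succ_of_ne_zero hne.card_ne_zero
      have hb' := hb.trans ((hU _).anti rfl (by positivity) hle)
      rw [hsame]
      rw [hk] at hb' ⊢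
      rw [Nat.succ_eq_add_one, evenValue_succ, Nat.add_sub_cancel, add_comm]
      exact add_le_add le_rfl hb'
    rcases le_total (ENNReal.ofReal (N.cap e - s.flow e)) (N.nodeValue (N.head e) (s.flow e))
      with hmin | hmin
    · refine ⟨_, .direct e he, hbound _ ?_⟩
      rw [linkValue_eq, min_eq_left hmin]
      exact ENNReal.ofReal_le_ofReal (by linarith [hcap e])
    · have hl : N.head e ≠ Fin.last n := by
        intro hl
        rw [hl, nodeValue_last] at hmin
        exact ENNReal.ofReal_ne_top (top_le_iff.1 hmin)
      obtain ⟨b, hb, hble⟩ := ih _ (N.tail_lt_head e) hl (hs.head_nonempty he hl)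
      refine ⟨_, .child e he b hb, hbound _ ?_⟩
      rw [linkValue_eq, min_eq_right hmin]
      obtain ⟨e', he'⟩ := N.exists_out _ hl
      have hin' := hin (N.head e)
      rw [huniq.inflow_head he hl] at hble hin'
      rw [(hU _).nodeValue_eq he' hin']
      exact (hble e' he').trans (evenValue_mono _ _ (Finset.card_le_card (activeOut_subset _ _)))

/-- Removing the last link of an attack lowers the cost of what remains by the cost of that link. -/
theorem AttackCost.exists_target (hG : N.IsRoutingPolicy G) (hU : ∀ v, N.UniformAt v)
    (huniq : N.HasUniqueInLinks) {s : FlowState n E} (hs : N.IsSettled lam G s)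
    {v : Fin (n + 1)} {b : ℝ≥0∞} (hb : N.AttackCost lam s v b) :
    ∃ e₀ ∈ s.links, ENNReal.ofReal (s.rescap e₀ - s.flow e₀) ≤ b ∧
      ∀ s' : FlowState n E, N.IsSettled lam G s' → s'.links ⊆ s.links → e₀ ∉ s'.links →
        (∀ e, s'.rescap e ≤ s.rescap e) → (∀ e, s'.rescap e ≤ N.cap e) →
        (∀ v, 0 ≤ N.inflow lam s' v) → N.inflow lam s' v = N.inflow lam s v →
        (N.activeOut s' v).Nonempty →
        ∃ b', N.AttackCost lam s' v b' ∧
          b' + ENNReal.ofReal (s.rescap e₀ - s.flow e₀) ≤ b := by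
  -- If the node has lost a link, a fresh attack on it fits into the even value held back for the
  -- remaining links.
  have shrink : ∀ (s' : FlowState n E) (e : E), N.IsSettled lam G s' →
      (∀ e, s'.rescap e ≤ N.cap e) → (∀ v, 0 ≤ N.inflow lam s' v) →
      N.inflow lam s' (N.tail e) = N.inflow lam s (N.tail e) →
      (N.activeOut s' (N.tail e)).Nonempty →
      (N.activeOut s' (N.tail e)).card < (N.activeOut s (N.tail e)).card →
      ∃ b', N.AttackCost lam s' (N.tail e) b' ∧
        b' ≤ N.evenValue e ((N.activeOut s (N.tail e)).card - 1)
          (N.inflow lam s (N.tail e)) := by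
    intro s' e hs' hcap hnn hin hne hlt
    obtain ⟨b', hb', hle⟩ :=
      hs'.exists_attackCost hG hU huniq hcap hnn (N.tail e) (N.tail_ne_last e) hne
    refine ⟨b', hb', (hle e rfl).trans ?_⟩
    rw [hin]
    exact evenValue_mono _ _ (by omega)
  induction hb with
  | direct e he =>
    refine ⟨e, he, le_self_add, fun s' hs' hsub hne _ hcap hnn hin hact => ?_⟩
    obtain ⟨b', hb', hle⟩ := shrink s' e hs' hcap hnn hin hact (Finset.card_lt_card
      ⟨activeOut_mono hsub _, fun h' =>
        hne (mem_activeOut.1 (h' (mem_activeOut.2 ⟨rfl, he⟩))).2⟩)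
    exact ⟨b', hb', by rw [add_comm]; gcongr⟩
  | child e he b hb ih =>
    obtain ⟨e₀, he₀, hd, hrem⟩ := ih
    refine ⟨e₀, he₀, hd.trans le_self_add, fun s' hs' hsub hne hres hcap hnn hin hact => ?_⟩
    -- With no link of the node lost and the same inflow, the flow on `e` is unchanged, so the
    -- attack below `e` goes on. Otherwise start afresh; the part `b` of the price then pays for
    -- `e₀`.
    rcases (activeOut_mono (N := N) hsub (N.tail e)).eq_or_ssubset with heq | hss
    · have he' : e ∈ s'.links :=
        (mem_activeOut.1 (heq.symm.subset (mem_activeOut.2 ⟨rfl, he⟩))).2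
      have hflow : s'.flow e = s.flow e := by
        rw [hs'.flow_eq e he', hs.flow_eq e he, heq, hin]
      obtain ⟨b', hb', hle⟩ := hrem s' hs' hsub hne hres hcap hnn
        (by rw [huniq.inflow_head he' hb.ne_last, huniq.inflow_head he hb.ne_last, hflow])
        (hs'.head_nonempty he' hb.ne_last)
      refine ⟨_, .child e he' b' hb', ?_⟩
      rw [heq, hin, add_right_comm]
      gcongr
    · obtain ⟨b', hb', hle⟩ := shrink s' e hs' hcap hnn hin hact (Finset.card_lt_card hss)
      exact ⟨b', hb', by rw [add_comm]; gcongr⟩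

/-- The disturbance `δ` with an additional capacity reduction `d` of the link `e₀` at time `T`. -/
def addAttack (δ : ℕ → E → ℝ) (T : ℕ) (e₀ : E) (d : ℝ) (t : ℕ) (e : E) : ℝ :=
  δ t e + if t = T ∧ e = e₀ then d else 0

theorem disturbanceMagnitude_addAttack (hδ : ∀ t e, 0 ≤ δ (t + 1) e) (T : ℕ) (e₀ : E) {d : ℝ}
    (hd : 0 ≤ d) : disturbanceMagnitude (addAttack δ (T + 1) e₀ d) =
      disturbanceMagnitude δ + ENNReal.ofReal d := by
  have hterm : ∀ t e, ENNReal.ofReal (addAttack δ (T + 1) e₀ d (t + 1) e) =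
      ENNReal.ofReal (δ (t + 1) e) + if t = T then (if e = e₀ then ENNReal.ofReal d else 0)
        else 0 := by
    intro t e
    rw [addAttack, ENNReal.ofReal_add (hδ t e) (by split_ifs <;> simp [hd])]
    congr 1
    by_cases h1 : t = T <;> by_cases h2 : e = e₀ <;> simp [h1, h2]
  simp only [disturbanceMagnitude, hterm]
  simp only [ENNReal.tsum_add, Finset.sum_add_distrib, tsum_ite_eq]
  rw [Finset.sum_ite_eq' Finset.univ e₀, if_pos (Finset.mem_univ _)]

theorem state_congr {δ' : ℕ → E → ℝ} {T : ℕ} (h : ∀ t < T, δ' (t + 1) = δ (t + 1)) :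
    N.state lam G δ' T = N.state lam G δ T := by
  induction T with
  | zero => rfl
  | succ T ih =>
    change N.step lam G _ _ = N.step lam G _ _
    rw [ih fun t ht => h t (ht.trans (Nat.lt_succ_self T)), h T (Nat.lt_succ_self T)]

theorem rescap_antitone (hδ : N.IsDisturbance δ) (e : E) :
    Antitone fun t => (N.state lam G δ t).rescap e :=
  antitone_nat_of_succ_le fun t => sub_le_self _ (hδ.1 t e)

section

variable (hG : N.IsRoutingPolicy G) (hU : ∀ v, N.UniformAt v) (huniq : N.HasUniqueInLinks)
  (hlam : 0 < lam)
include hG hU huniq hlam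

/-- Each round removes the spare capacity of one link and waits. Links strictly decrease in number,
and money spent plus remaining price stays at most `B`. -/
theorem exists_failing_disturbance_of_attackCost {B : ℝ≥0∞} (m : ℕ) :
    ∀ (δ : ℕ → E → ℝ) (T : ℕ) (b : ℝ≥0∞), N.IsDisturbance δ → (∀ t ≥ T, δ (t + 1) = 0) →
      N.SettledFrom lam G δ T → (N.state lam G δ T).links.card = m →
      N.AttackCost lam (N.state lam G δ T) 0 b → disturbanceMagnitude δ + b ≤ B →
      ∃ δ', N.IsDisturbance δ' ∧ ¬ N.IsTransferring lam G δ' ∧ disturbanceMagnitude δ' ≤ B := by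
  induction m using Nat.strong_induction_on with
  | _ m ih =>
    intro δ T b hδ hzero hT hm hb hB
    have hs := hT.isSettled
    obtain ⟨e₀, he₀, hdb, hrem⟩ := hb.exists_target hG hU huniq hs
    set d := (N.state lam G δ T).rescap e₀ - (N.state lam G δ T).flow e₀ with hd
    have hd0 : 0 ≤ d := (sub_pos.2 (hs.flow_lt e₀ he₀)).le
    have hflow0 := hG.flow_nonneg hlam.le he₀
    set δ' := addAttack δ (T + 1) e₀ d with hδ'
    have hagree : ∀ t ≠ T, δ' (t + 1) = δ (t + 1) := fun t ht => by
      funext e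
      simp [hδ', addAttack, ht]
    have hnonneg : ∀ t e, 0 ≤ δ' (t + 1) e := fun t e =>
      add_nonneg (hδ.1 t e) (by split_ifs <;> simp [hd0])
    have hstate : N.state lam G δ' T = N.state lam G δ T :=
      state_congr fun t ht => hagree t ht.ne
    -- The reduction is admissible: it stops at the current flow, which is nonnegative, and nothing
    -- is removed later.
    have hrescap : ∀ t, 0 ≤ (N.state lam G δ' t).rescap e₀ := by
      have hsucc : (N.state lam G δ' (T + 1)).rescap e₀ = (N.state lam G δ T).flow e₀ := by
        change (N.state lam G δ' T).rescap e₀ - δ' (T + 1) e₀ = _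
        rw [hstate]
        simp [hδ', addAttack, hzero T le_rfl, hd]
      intro t
      rcases le_or_gt t (T + 1) with ht | ht
      · exact (hflow0.trans_eq hsucc.symm).trans
          (antitone_nat_of_succ_le (f := fun t => (N.state lam G δ' t).rescap e₀)
            (fun t => sub_le_self _ (hnonneg t e₀)) ht)
      · obtain ⟨k, rfl⟩ := Nat.exists_eq_add_of_le ht.le
        have : (N.state lam G δ' (T + 1 + k)).rescap e₀ = (N.state lam G δ T).flow e₀ := by
          clear ht
          induction k with
          | zero => exact hsucc
          | succ k ihk =>
            change (N.state lam G δ' (T + 1 + k)).rescap e₀ - δ' (T + 1 + k + 1) e₀ = _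
            rw [ihk, hagree _ (by omega), hzero _ (by omega)]
            simp
        rw [this]
        exact hflow0
    have hdist : N.IsDisturbance δ' := by
      refine ⟨hnonneg, fun t e => ?_⟩
      by_cases hee : e = e₀
      · have := hrescap t
        rw [rescap_state] at this
        rw [hee]
        linarith
      · refine le_of_eq_of_le (Finset.sum_congr rfl fun s _ => ?_) (hδ.2 t e)
        simp [hδ', addAttack, hee]
    have hmag : disturbanceMagnitude δ' = disturbanceMagnitude δ + ENNReal.ofReal d :=
      disturbanceMagnitude_addAttack hδ.1 T e₀ hd0
    obtain ⟨h1, -, h3⟩ := hT (T + 1) (Nat.le_succ T)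
    have hlinks : (N.state lam G δ' (T + 1)).links = (N.state lam G δ T).links := by
      rw [← h1]
      change (N.step lam G _ (N.state lam G δ' T)).links = _
      rw [hstate]; rfl
    have hflow : (N.state lam G δ' (T + 1)).flow = (N.state lam G δ T).flow := by
      rw [← h3]
      change (N.step lam G _ (N.state lam G δ' T)).flow = _
      rw [hstate]; rfl
    -- The capacity drops at time `T + 1`, where it equals the flow; the link is gone at `T + 2`.
    have hfail : e₀ ∉ (N.state lam G δ' (T + 2)).links := by
      intro hmem
      have hlt := (Finset.mem_filter.1 hmem).2.1
      rw [hflow] at hlt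
      change _ < (N.state lam G δ' T).rescap e₀ - δ' (T + 1) e₀ at hlt
      rw [hstate] at hlt
      simp [hδ', addAttack, hzero T le_rfl, hd] at hlt
    obtain ⟨T', hTT', hT'⟩ := N.exists_settledFrom lam G δ' (T + 2)
    have hsub : (N.state lam G δ' T').links ⊆ (N.state lam G δ T).links :=
      hlinks ▸ N.links_antitone lam G δ' ((Nat.le_succ _).trans hTT')
    have hnot : e₀ ∉ (N.state lam G δ' T').links := fun h' =>
      hfail (N.links_antitone lam G δ' hTT' h')
    rcases (N.activeOut (N.state lam G δ' T') 0).eq_empty_or_nonempty with hdead | halive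
    · refine ⟨δ', hdist, not_isTransferring_of_activeOut_eq_empty hG hlam hdead, ?_⟩
      rw [hmag]
      exact (add_le_add le_rfl hdb).trans hB
    · have hanti := fun e => rescap_antitone (lam := lam) (G := G) hdist e
      obtain ⟨b', hb', hle⟩ := hrem _ hT'.isSettled hsub hnot
        (fun e => hstate ▸ hanti e ((Nat.le_add_right T 2).trans hTT'))
        (fun e => hanti e (Nat.zero_le T'))
        (hG.inflow_nonneg hlam.le T') (by rw [inflow_zero, inflow_zero]) halive
      refine ih _ ?_ δ' T' b' hdist (fun t ht => ?_) hT' rfl hb' ?_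
      · rw [← hm]
        exact Finset.card_lt_card ⟨hsub, fun h' => hnot (h' he₀)⟩
      · rw [hagree t (by omega), hzero t (by omega)]
      · rw [hmag, add_assoc, add_comm (ENNReal.ofReal d)]
        exact (add_le_add le_rfl hle).trans hB

theorem IsRoutingPolicy.resilience_le_bpaBound : N.resilience lam G ≤ N.bpaBound lam := by
  suffices h : ∃ δ', N.IsDisturbance δ' ∧ ¬ N.IsTransferring lam G δ' ∧
      disturbanceMagnitude δ' ≤ N.bpaBound lam by
    obtain ⟨δ', h1, h2, h3⟩ := h
    refine le_trans ?_ h3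
    rw [resilience]
    exact iInf_le_of_le δ' (iInf_le_of_le h1 (iInf_le _ h2))
  have hδ : N.IsDisturbance (0 : ℕ → E → ℝ) :=
    ⟨fun _ _ => le_rfl, fun t e => by simpa using (N.cap_pos e).le⟩
  have hmag : disturbanceMagnitude (0 : ℕ → E → ℝ) = 0 := by simp [disturbanceMagnitude]
  obtain ⟨T, -, hT⟩ := N.exists_settledFrom lam G 0 0
  rcases (N.activeOut (N.state lam G 0 T) 0).eq_empty_or_nonempty with hdead | halive
  · exact ⟨0, hδ, not_isTransferring_of_activeOut_eq_empty hG hlam hdead, by simp [hmag]⟩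
  · obtain ⟨b, hb, hle⟩ := hT.isSettled.exists_attackCost hG hU huniq
      (fun e => rescap_antitone hδ e (Nat.zero_le T)) (hG.inflow_nonneg hlam.le T) 0
      N.zero_ne_last halive
    refine exists_failing_disturbance_of_attackCost hG hU huniq hlam _ 0 T b hδ (fun _ _ => rfl)
      hT rfl hb ?_
    obtain ⟨e, he⟩ := N.exists_out 0 N.zero_ne_last
    rw [hmag, zero_add, bpaBound, ← nodeValue, (hU 0).nodeValue_eq he hlam.le]
    refine (hle e he).trans ?_
    rw [inflow_zero]
    exact evenValue_mono _ _ (Finset.card_le_card (activeOut_subset _ _))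

end

/-- The policy that splits every inflow evenly among the active links. -/
noncomputable def evenRouting (n : ℕ) (E : Type*) [DecidableEq E] : RoutingMap n E :=
  fun _ J μ e => if e ∈ J then μ / J.card else 0

theorem isDistributedPolicy_evenRouting : N.IsDistributedPolicy (evenRouting n E) := by
  refine ⟨fun v hv J hJ hne μ hμ => ⟨fun e => ?_, fun e he => if_neg he, ?_⟩,
    fun v hv J K hJ hKJ hK μ hμ e he => ?_⟩
  · unfold evenRouting
    split_ifs <;> positivity
  -- Only the total mass matters here, so both bounds are set to the even share itself.
  · exact (UniformAt.even_mem_feasibleSplits (C := fun _ => μ / J.card) hne hμ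
      (r := fun _ => μ / J.card) (fun _ _ => le_rfl) fun _ _ => le_rfl).2.2
  · simp only [evenRouting, he, hKJ he, if_true]
    exact div_le_div_of_nonneg_left hμ (by exact_mod_cast hK.card_pos)
      (by exact_mod_cast Finset.card_le_card hKJ)

theorem isEvenWherePositive_evenRouting : N.IsEvenWherePositive (evenRouting n E) :=
  fun _ _ _ _ _ _ he _ => if_pos he

theorem IsEvenWherePositive.resilience_eq_bpaBound (hE : N.IsEvenWherePositive G)
    (hG : N.IsRoutingPolicy G) (hU : ∀ v, N.UniformAt v) (huniq : N.HasUniqueInLinks)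
    (hlam : 0 < lam) : N.resilience lam G = N.bpaBound lam :=
  le_antisymm (hG.resilience_le_bpaBound hU huniq hlam)
    (hE.bpaBound_le_resilience hG hU hlam.le huniq)

/-- A BPA routing need not be link monotone, so the supremum is attained by even splitting, which
is. -/
theorem maxResilience_eq_bpaBound (hU : ∀ v, N.UniformAt v) (huniq : N.HasUniqueInLinks)
    (hlam : 0 < lam) : N.maxResilience lam = N.bpaBound lam := by
  refine le_antisymm (iSup₂_le fun G hG => hG.1.resilience_le_bpaBound hU huniq hlam) ?_
  rw [← isEvenWherePositive_evenRouting.resilience_eq_bpaBound isDistributedPolicy_evenRouting.1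
    hU huniq hlam]
  exact le_iSup₂_of_le _ isDistributedPolicy_evenRouting le_rfl

end UpperBound

end FlowNetwork

theorem proposition3 {n : ℕ} {E : Type*} [Fintype E] [DecidableEq E] (N : FlowNetwork n E)
    (hTree : N.IsDirectedTree) (hSymm : N.IsSymmetric) (lam : ℝ) (hlam : 0 < lam)
    (G : RoutingMap n E) (hG : N.IsRoutingPolicy G) (hBPA : N.IsBPARouting G) :
    (∀ δ : ℕ → E → ℝ, N.IsDisturbance δ → disturbanceMagnitude δ < N.bpaBound lam →
      N.IsTransferring lam G δ) ∧
    N.resilience lam G = N.maxResilience lam := by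
  have hU := FlowNetwork.uniformAt_of_isSymmetric hSymm
  have huniq := hTree.hasUniqueInLinks
  have hE := hBPA.isEvenWherePositive hU
  refine ⟨fun δ hδ hlt => hE.isTransferring hG hU hlam.le huniq hδ hlt, ?_⟩
  rw [hE.resilience_eq_bpaBound hG hU huniq hlam,
    FlowNetwork.maxResilience_eq_bpaBound hU huniq hlam]
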